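/- Consider the following dual pivot Quicksort (Yaroslavskiy's partitioning method), which sorts an array $A$ of elements of a linearly ordered set in the index range $\mathit{left},\dots,\mathit{right}$. If $\mathit{right}-\mathit{left}\ge 1$, then: 1. compare $A[\mathit{left}]$ with $A[\mathit{right}]$, and swap them if $A[\mathit{left}]>A[\mathit{right}]$; let $p$ and $q$ be the resulting entries $A[\mathit{left}]$ and $A[\mathit{right}]$; set $\ell\gets\mathit{left}+1$, $g\gets\mathit{right}-1$, $k\gets\ell$; 2. while $k\le g$: if $A[k]<p$, swap $A[k]$ and $A[\ell]$ and set $\ell\gets\ell+1$; otherwise, if $A[k]>q$, then (a) while $A[g]>q$ and $k<g$, set $g\gets g-1$; (b) swap $A[k]$ and $A[g]$ and set $g\gets g-1$; (c) if $A[k]<p$, swap $A[k]$ and $A[\ell]$ and set $\ell\gets\ell+1$. In every case, then set $k\gets k+1$; 3. set $\ell\gets\ell-1$ and $g\gets g+1$, swap $A[\mathit{left}]$ and $A[\ell]$, and swap $A[\mathit{right}]$ and $A[g]$; 4. recursively sort the ranges $\mathit{left},\dots,\ell-1$, then $\ell+1,\dots,g-1$, then $g+1,\dots,\mathit{right}$.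 If $\mathit{right}-\mathit{left}<1$, nothing is done. A key comparison is counted each time one of the five tests comparing array elements (the test in step 1, and the tests $A[k]<p$, $A[k]>q$, $A[g]>q$, $A[k]<p$ in step 2) is evaluated; the condition in (a) is evaluated from left to right, so that each of its evaluations costs exactly one key comparison. Every executed swap instruction counts as one swap, even if the two indices coincide. Let $C_n$ and $S_n$ be the expected number of key comparisons and the expected number of swaps, respectively, when the algorithm is run on the range $1,\dots,n$ of an array containing a uniformly random permutation of $\{1,\dots,n\}$. Let $\mathcal H_n=\sum_{i=1}^n \frac1i$, and let $\gamma=\lim_{n\to\infty}(\mathcal H_n-\ln n)=0.577216\ldots$ be the Euler–Mascheroni constant. Then for every $n\ge 4$ $$C_n=\tfrac{19}{10}(n+1)\mathcal H_{n+1}-\tfrac{711}{200}(n+1)+\tfrac32,\qquad S_n=\tfrac35(n+1)\mathcal H_{n+1}-\tfrac{27}{100}(n+1)-\tfrac7{12}.$$ Consequently, as $n\to\infty$, $$C_n=\tfrac{19}{10}\,n\ln n+\bigl(\tfrac{19}{10}\gamma-\tfrac{711}{200}\bigr)n+\mathcal O(\ln n),\qquad S_n=\tfrac35\,n\ln n+\bigl(\tfrac35\gamma-\tfrac{27}{100}\bigr)n+\mathcal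 O(\ln n),$$ where the coefficients of $n$ are $-2.46$ and $0.08$, respectively, each with an error less than $0.005$. (That is, $C_n\approx 1.9\,n\ln n-2.46\,n+\mathcal O(\ln n)$ and $S_n\approx 0.6\,n\ln n+0.08\,n+\mathcal O(\ln n)$.) -/

import Mathlib

open Filter Asymptotics
open scoped Nat

namespace DualPivotQuicksort

/-- The state of a run: the contents of the array `A` (indexed by integers; only the positions
inside the range that is being sorted are ever accessed), the number of key comparisons made so
far, and the number of swaps made so far. -/
structure State (α : Type*) where
  arr : ℤ → α
  comparisons : ℕ
  swaps : ℕ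

namespace State

variable {α : Type*}

/-- Account for one key comparison. -/
def tick (s : State α) : State α :=
  { s with comparisons := s.comparisons + 1 }

/-- `Swap A[i] and A[j]`; it counts as one swap, also when `i = j`. -/
def swap (s : State α) (i j : ℤ) : State α :=
  { s with arr := s.arr ∘ Equiv.swap i j, swaps := s.swaps + 1 }

end State

section Algorithm

variable {α : Type*} [LinearOrder α]

/-- `while A[g] > q and k < g do g ← g - 1 end while`.
Each evaluation of the loop condition starts with the key comparison `A[g] > q`.
Returns the final value of `g` and the state. -/
def innerLoop (q : α) (k g : ℤ) (s : State α) : ℤ × State α :=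
  if _h : q < s.arr g ∧ k < g then
    innerLoop q k (g - 1) s.tick
  else
    (g, s.tick)
termination_by (g - k).toNat
decreasing_by omega

theorem innerLoop_fst_le (q : α) (k g : ℤ) (s : State α) : (innerLoop q k g s).1 ≤ g := by
  fun_induction innerLoop q k g s with
  | case1 g s h ih => omega
  | case2 g s h => exact le_rfl

theorem le_innerLoop_fst (q : α) (k g : ℤ) (s : State α) (hkg : k ≤ g) :
    k ≤ (innerLoop q k g s).1 := by
  fun_induction innerLoop q k g s with
  | case1 g s h ih => exact ih (by omega)
  | case2 g s h => exact hkg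

/-- The outer loop `while k ≤ g do … end while` of the partitioning step, with pivots `p ≤ q`.
Returns the final values of `ℓ` and `g` and the state. -/
def outerLoop (p q : α) (l g k : ℤ) (s : State α) : ℤ × ℤ × State α :=
  if _h : k ≤ g then
    -- key comparison `A[k] < p`
    let s₁ := s.tick
    if s₁.arr k < p then
      outerLoop p q (l + 1) g (k + 1) (s₁.swap k l)
    else
      -- key comparison `A[k] > q`
      let s₂ := s₁.tick
      if q < s₂.arr k then
        let r := innerLoop q k g s₂
        -- swap `A[k]` and `A[g]`, decrement `g`, then key comparison `A[k] < p`
        let s₃ := (r.2.swap k r.1).tick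
        if s₃.arr k < p then
          outerLoop p q (l + 1) (r.1 - 1) (k + 1) (s₃.swap k l)
        else
          outerLoop p q l (r.1 - 1) (k + 1) s₃
      else
        outerLoop p q l g (k + 1) s₂
  else
    (l, g, s)
termination_by (g + 1 - k).toNat
decreasing_by
  · omega
  · have := innerLoop_fst_le q k g s.tick.tick
    omega
  · have := innerLoop_fst_le q k g s.tick.tick
    omega
  · omega

theorem outerLoop_bounds (p q : α) (l g k : ℤ) (s : State α) (hlk : l ≤ k) (hkg : k ≤ g + 2) :
    l ≤ (outerLoop p q l g k s).1 ∧
      (outerLoop p q l g k s).1 ≤ (outerLoop p q l g k s).2.1 + 2 ∧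
      (outerLoop p q l g k s).2.1 ≤ g := by
  fun_induction outerLoop p q l g k s with
  | case1 l g k s h s₁ h₁ ih =>
    have := ih (by omega) (by omega)
    omega
  | case2 l g k s h s₁ h₁ s₂ h₂ r s₃ h₃ ih =>
    have hr : r.1 ≤ g := innerLoop_fst_le q k g s₂
    have hr' : k ≤ r.1 := le_innerLoop_fst q k g s₂ h
    have := ih (by omega) (by omega)
    omega
  | case3 l g k s h s₁ h₁ s₂ h₂ r s₃ h₃ ih =>
    have hr : r.1 ≤ g := innerLoop_fst_le q k g s₂
    have hr' : k ≤ r.1 := le_innerLoop_fst q k g s₂ h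
    have := ih (by omega) (by omega)
    omega
  | case4 l g k s h s₁ h₁ s₂ h₂ ih =>
    have := ih (by omega) (by omega)
    omega
  | case5 l g k s h =>
    refine ⟨le_rfl, ?_, le_rfl⟩
    simp only
    omega

/-- The pivot selection: one key comparison of `A[left]` with `A[right]`; if the first is
larger, they are swapped. Afterwards `p = A[left]` and `q = A[right]`. -/
def orderPivots (left right : ℤ) (s : State α) : State α :=
  if s.arr right < s.arr left then s.tick.swap left right else s.tick

/-- One partitioning step on the range `left, …, right`. Returns the final positions `ℓ` and `g`
of the two pivots and the state. -/
def partitionStep (left right : ℤ) (s : State α) : ℤ × ℤ × State α :=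
  let s₀ := orderPivots left right s
  let r := outerLoop (s₀.arr left) (s₀.arr right) (left + 1) (right - 1) (left + 1) s₀
  let l := r.1 - 1
  let g := r.2.1 + 1
  (l, g, (r.2.2.swap left l).swap right g)

theorem partitionStep_bounds (left right : ℤ) (s : State α) (h : 1 ≤ right - left) :
    left ≤ (partitionStep left right s).1 ∧
      (partitionStep left right s).1 ≤ (partitionStep left right s).2.1 ∧
      (partitionStep left right s).2.1 ≤ right := by
  have := outerLoop_bounds ((orderPivots left right s).arr left)
    ((orderPivots left right s).arr right) (left + 1) (right - 1) (left + 1)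
    (orderPivots left right s) le_rfl (by omega)
  simp only [partitionStep]
  omega

/-- Yaroslavskiy's dual pivot Quicksort on the range `left, …, right`. -/
def quicksort (left right : ℤ) (s : State α) : State α :=
  if _h : 1 ≤ right - left then
    let r := partitionStep left right s
    let s₁ := quicksort left (r.1 - 1) r.2.2
    let s₂ := quicksort (r.1 + 1) (r.2.1 - 1) s₁
    quicksort (r.2.1 + 1) right s₂
  else
    s
termination_by (right - left + 1).toNat
decreasing_by
  all_goals
    have := partitionStep_bounds left right s _h
    omega

end Algorithm

/-- The initial state for a permutation of `{1, …, n}`: `A[1], …, A[n]` hold the values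
`π(1), …, π(n)` (with the shift by one coming from `Fin n = {0, …, n-1}`), and both counters
are zero. -/
def initialState {n : ℕ} (π : Equiv.Perm (Fin n)) : State ℕ where
  arr i := if h : 1 ≤ i ∧ i ≤ n then (π ⟨(i - 1).toNat, by omega⟩ : ℕ) + 1 else 0
  comparisons := 0
  swaps := 0

/-- Run the algorithm on `A[1], …, A[n]`. -/
def run {n : ℕ} (π : Equiv.Perm (Fin n)) : State ℕ :=
  quicksort 1 n (initialState π)

/-- Expected number of key comparisons, each permutation having probability `1 / n!`. -/
noncomputable def expectedComparisons (n : ℕ) : ℝ :=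
  (∑ π : Equiv.Perm (Fin n), ((run π).comparisons : ℝ)) / (n ! : ℝ)

/-- Expected number of swaps, each permutation having probability `1 / n!`. -/
noncomputable def expectedSwaps (n : ℕ) : ℝ :=
  (∑ π : Equiv.Perm (Fin n), ((run π).swaps : ℝ)) / (n ! : ℝ)

end DualPivotQuicksort

/-! Comparisons and swaps are handled together through the linear functional `State.cost u v`; the
weights `(1, 0)` and `(0, 1)` give the two formulas.

The cost of one partitioning step is computed exactly. The pointers `k` and `g` sweep the inner
range from both ends, so the cost is a sum of indicators "small" or "large" of the original entries
over index sets that depend only on where `g` stops (`outerLoop_cost`). That place is forced by the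
rank of the larger pivot (`firstStep_spec`). Hence, once the pivots are fixed, the index sets are
deterministic, and by symmetry an inner position holds a small entry with probability `p / N` and a
large one with probability `(N + 1 - q) / N` (`sum_pivotFiber_apply`, with `0`-based pivot values `p
< q` and `N` inner positions). Averaging over the pivots gives `toll`.

The subproblems are again uniformly random. The step compares entries only with the pivots, so
relabelling the values strictly between two consecutive pivots, or beyond an extreme one, commutes
with partitioning (`Sim.partitionStep`). Averaging over all such relabellings replaces a recursive
call by the mean cost of its size (`sum_pivotFiber_sortCost`).

With `M n` the mean cost, this yields `n (n - 1) M n = n (n - 1) toll n + 6 ∑ q < n, ∑ p < q, M p`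
for `n ≥ 3`. The second difference of the double sum is `M` itself, so checking a closed form
reduces to one algebraic identity and initial values. The asymptotics follow from `H n = log n + γ +
O(1 / n)` and numerical bounds on `γ`. -/

namespace DualPivotQuicksort

/-! ### Simulation: runs under shifts of positions and relabellings of values -/

/-- On the positions `lo, …, hi`, with values in `S`, the array of `s'` is the image under `f` of
the array of `s`, shifted by `d`; the counters of `s'` exceed those of `s` by `c` and `w`. -/
structure Sim {α β : Type*} (f : α → β) (S : Set α) (lo hi d c w : ℤ)
    (s : State α) (s' : State β) : Prop where
  mem : ∀ i, lo ≤ i → i ≤ hi → s.arr i ∈ S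
  arr : ∀ i, lo ≤ i → i ≤ hi → s'.arr (i + d) = f (s.arr i)
  comparisons : (s'.comparisons : ℤ) = s.comparisons + c
  swaps : (s'.swaps : ℤ) = s.swaps + w

/-- `f` preserves the order relation between `p` and the elements of `S`. -/
def Respects {α β : Type*} [LT α] [LT β] (f : α → β) (S : Set α) (p : α) : Prop :=
  ∀ x ∈ S, (f x < f p ↔ x < p) ∧ (f p < f x ↔ p < x)

theorem swap_mem_range {lo hi i j x : ℤ} (hi₁ : lo ≤ i) (hi₂ : i ≤ hi) (hj₁ : lo ≤ j)
    (hj₂ : j ≤ hi) (hx₁ : lo ≤ x) (hx₂ : x ≤ hi) :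
    lo ≤ Equiv.swap i j x ∧ Equiv.swap i j x ≤ hi := by
  rw [Equiv.swap_apply_def]
  split_ifs <;> omega

namespace Sim

variable {α β : Type*} {f : α → β} {S : Set α} {lo hi d c w : ℤ} {s : State α} {s' : State β}

theorem tick (h : Sim f S lo hi d c w s s') : Sim f S lo hi d c w s.tick s'.tick where
  mem := h.mem
  arr := h.arr
  comparisons := by
    have := h.comparisons
    simp only [State.tick]
    omega
  swaps := h.swaps

theorem swap (h : Sim f S lo hi d c w s s') {i j : ℤ} (hi₁ : lo ≤ i) (hi₂ : i ≤ hi)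
    (hj₁ : lo ≤ j) (hj₂ : j ≤ hi) :
    Sim f S lo hi d c w (s.swap i j) (s'.swap (i + d) (j + d)) where
  mem x hx₁ hx₂ :=
    have hx := swap_mem_range hi₁ hi₂ hj₁ hj₂ hx₁ hx₂
    h.mem _ hx.1 hx.2
  arr x hx₁ hx₂ := by
    have hx := swap_mem_range hi₁ hi₂ hj₁ hj₂ hx₁ hx₂
    have e : Equiv.swap (i + d) (j + d) (x + d) = Equiv.swap i j x + d := by
      simp only [Equiv.swap_apply_def, add_left_inj]
      split_ifs <;> rfl
    simp only [State.swap, Function.comp_apply, e]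
    exact h.arr _ hx.1 hx.2
  comparisons := h.comparisons
  swaps := by
    have := h.swaps
    simp only [State.swap]
    omega

variable [LinearOrder α] [LinearOrder β]

theorem innerLoop {q : α} (hq : Respects f S q) {k g : ℤ} (h : Sim f S lo hi d c w s s')
    (hk : lo ≤ k) (hkg : k ≤ g) (hg : g ≤ hi) :
    (innerLoop (f q) (k + d) (g + d) s').1 = (innerLoop q k g s).1 + d ∧
      Sim f S lo hi d c w (innerLoop q k g s).2 (innerLoop (f q) (k + d) (g + d) s').2 := by
  fun_induction DualPivotQuicksort.innerLoop q k g s generalizing s' with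
  | case1 g s hc ih =>
    rw [DualPivotQuicksort.innerLoop, h.arr g (by omega) hg, dif_pos
      ⟨(hq _ (h.mem g (by omega) hg)).2.2 hc.1, by omega⟩,
      show g + d - 1 = g - 1 + d by ring]
    exact ih h.tick (by omega) (by omega)
  | case2 g s hc =>
    rw [DualPivotQuicksort.innerLoop, h.arr g (by omega) hg, dif_neg]
    · exact ⟨rfl, h.tick⟩
    · rintro ⟨h₁, h₂⟩
      exact hc ⟨(hq _ (h.mem g (by omega) hg)).2.1 h₁, by omega⟩

theorem outerLoop {p q : α} (hp : Respects f S p) (hq : Respects f S q) {l g k : ℤ}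
    (h : Sim f S lo hi d c w s s') (hl : lo ≤ l) (hlk : l ≤ k) (hg : g ≤ hi) :
    (outerLoop (f p) (f q) (l + d) (g + d) (k + d) s').1 = (outerLoop p q l g k s).1 + d ∧
    (outerLoop (f p) (f q) (l + d) (g + d) (k + d) s').2.1 =
      (outerLoop p q l g k s).2.1 + d ∧
    Sim f S lo hi d c w (outerLoop p q l g k s).2.2
      (outerLoop (f p) (f q) (l + d) (g + d) (k + d) s').2.2 := by
  fun_induction DualPivotQuicksort.outerLoop p q l g k s generalizing s' with
  | case1 l g k s hkg s₁ h₁ =>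
    rename_i ih
    have hs₁ : Sim f S lo hi d c w s₁ s'.tick := h.tick
    have e₁ := hs₁.arr k (by omega) (by omega)
    have m₁ := hs₁.mem k (by omega) (by omega)
    rw [DualPivotQuicksort.outerLoop, dif_pos (by omega)]
    simp only [e₁, (hp _ m₁).1, h₁, if_true]
    rw [show l + d + 1 = l + 1 + d by ring, show k + d + 1 = k + 1 + d by ring]
    exact ih (hs₁.swap (by omega) (by omega) (by omega) (by omega)) (by omega) (by omega) hg
  | case2 l g k s hkg s₁ h₁ s₂ h₂ r s₃ h₃ =>
    rename_i ih
    have hs₁ : Sim f S lo hi d c w s₁ s'.tick := h.tick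
    have hs₂ : Sim f S lo hi d c w s₂ s'.tick.tick := hs₁.tick
    have e₁ := hs₁.arr k (by omega) (by omega)
    have m₁ := hs₁.mem k (by omega) (by omega)
    have e₂ := hs₂.arr k (by omega) (by omega)
    have m₂ := hs₂.mem k (by omega) (by omega)
    have hr : r.1 ≤ g := innerLoop_fst_le q k g s₂
    have hr' : k ≤ r.1 := le_innerLoop_fst q k g s₂ hkg
    have hi : _ = r.1 + d ∧ Sim f S lo hi d c w r.2 _ :=
      hs₂.innerLoop hq (k := k) (by omega) hkg hg
    rw [DualPivotQuicksort.outerLoop, dif_pos (by omega)]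
    simp only [e₁, (hp _ m₁).1, h₁, if_false, e₂, (hq _ m₂).2, h₂, if_true]
    generalize DualPivotQuicksort.innerLoop (f q) (k + d) (g + d) s'.tick.tick = r' at hi ⊢
    obtain ⟨g', t⟩ := r'
    obtain ⟨rfl, i₂⟩ := hi
    have hs₃ : Sim f S lo _ d c w s₃ _ :=
      (i₂.swap (i := k) (j := r.1) (by omega) (by omega) (by omega) (by omega)).tick
    have e₃ := hs₃.arr k (by omega) (by omega)
    have m₃ := hs₃.mem k (by omega) (by omega)
    simp only [e₃, (hp _ m₃).1, h₃, if_true]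
    rw [show l + d + 1 = l + 1 + d by ring, show k + d + 1 = k + 1 + d by ring,
      show r.1 + d - 1 = r.1 - 1 + d by ring]
    exact ih (hs₃.swap (by omega) (by omega) (by omega) (by omega)) (by omega) (by omega)
      (by omega)
  | case3 l g k s hkg s₁ h₁ s₂ h₂ r s₃ h₃ =>
    rename_i ih
    have hs₁ : Sim f S lo hi d c w s₁ s'.tick := h.tick
    have hs₂ : Sim f S lo hi d c w s₂ s'.tick.tick := hs₁.tick
    have e₁ := hs₁.arr k (by omega) (by omega)
    have m₁ := hs₁.mem k (by omega) (by omega)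
    have e₂ := hs₂.arr k (by omega) (by omega)
    have m₂ := hs₂.mem k (by omega) (by omega)
    have hr : r.1 ≤ g := innerLoop_fst_le q k g s₂
    have hr' : k ≤ r.1 := le_innerLoop_fst q k g s₂ hkg
    have hi : _ = r.1 + d ∧ Sim f S lo hi d c w r.2 _ :=
      hs₂.innerLoop hq (k := k) (by omega) hkg hg
    rw [DualPivotQuicksort.outerLoop, dif_pos (by omega)]
    simp only [e₁, (hp _ m₁).1, h₁, if_false, e₂, (hq _ m₂).2, h₂, if_true]
    generalize DualPivotQuicksort.innerLoop (f q) (k + d) (g + d) s'.tick.tick = r' at hi ⊢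
    obtain ⟨g', t⟩ := r'
    obtain ⟨rfl, i₂⟩ := hi
    have hs₃ : Sim f S lo _ d c w s₃ _ :=
      (i₂.swap (i := k) (j := r.1) (by omega) (by omega) (by omega) (by omega)).tick
    have e₃ := hs₃.arr k (by omega) (by omega)
    have m₃ := hs₃.mem k (by omega) (by omega)
    simp only [e₃, (hp _ m₃).1, h₃, if_false]
    rw [show k + d + 1 = k + 1 + d by ring,
      show r.1 + d - 1 = r.1 - 1 + d by ring]
    exact ih hs₃ hl (by omega) (by omega)
  | case4 l g k s hkg s₁ h₁ s₂ h₂ =>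
    rename_i ih
    have hs₁ : Sim f S lo hi d c w s₁ s'.tick := h.tick
    have hs₂ : Sim f S lo hi d c w s₂ s'.tick.tick := hs₁.tick
    have e₁ := hs₁.arr k (by omega) (by omega)
    have m₁ := hs₁.mem k (by omega) (by omega)
    have e₂ := hs₂.arr k (by omega) (by omega)
    have m₂ := hs₂.mem k (by omega) (by omega)
    rw [DualPivotQuicksort.outerLoop, dif_pos (by omega)]
    simp only [e₁, (hp _ m₁).1, h₁, if_false, e₂, (hq _ m₂).2, h₂]
    rw [show k + d + 1 = k + 1 + d by ring]
    exact ih hs₂ hl (by omega) hg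
  | case5 l g k s hkg =>
    rw [DualPivotQuicksort.outerLoop, dif_neg (by omega)]
    exact ⟨rfl, rfl, h⟩

end Sim
end DualPivotQuicksort

namespace DualPivotQuicksort

namespace Sim

variable {α β : Type*} {f : α → β} {S : Set α} {lo hi d c w : ℤ} {s : State α} {s' : State β}
variable [LinearOrder α] [LinearOrder β]

theorem orderPivots {left right : ℤ} (hl : Respects f S (s.arr left))
    (h : Sim f S lo hi d c w s s') (h₁ : lo ≤ left) (h₂ : left ≤ right) (h₃ : right ≤ hi) :
    Sim f S lo hi d c w (orderPivots left right s)
      (orderPivots (left + d) (right + d) s') := by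
  unfold DualPivotQuicksort.orderPivots
  rw [h.arr left h₁ (by omega), h.arr right (by omega) h₃, if_congr
    (hl _ (h.mem right (by omega) h₃)).1 rfl rfl]
  split_ifs
  · exact h.tick.swap h₁ (by omega) (by omega) h₃
  · exact h.tick

/-- Every key comparison of the step involves `A[left]` or `A[right]`, so `f` has to respect only
these two entries and may scramble the other values. This freedom is what makes the subarrays
random. -/
theorem partitionStep {left right : ℤ} (hl : Respects f S (s.arr left))
    (hr : Respects f S (s.arr right)) (h : Sim f S lo hi d c w s s')
    (h₁ : lo ≤ left) (h₂ : left ≤ right) (h₃ : right ≤ hi)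
    (hlt : 1 ≤ right - left) :
    (partitionStep (left + d) (right + d) s').1 = (partitionStep left right s).1 + d ∧
    (partitionStep (left + d) (right + d) s').2.1 = (partitionStep left right s).2.1 + d ∧
    Sim f S lo hi d c w (partitionStep left right s).2.2
      (partitionStep (left + d) (right + d) s').2.2 := by
  have hp := h.orderPivots hl h₁ h₂ h₃
  have hl' : Respects f S ((DualPivotQuicksort.orderPivots left right s).arr left) ∧
      Respects f S ((DualPivotQuicksort.orderPivots left right s).arr right) := by
    unfold DualPivotQuicksort.orderPivots
    split_ifs
    · simpa [State.swap, State.tick] using ⟨hr, hl⟩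
    · exact ⟨hl, hr⟩
  have hb := partitionStep_bounds left right s hlt
  have ho := hp.outerLoop hl'.1 hl'.2 (l := left + 1) (g := right - 1)
    (k := left + 1) (by omega) le_rfl (by omega)
  rw [← hp.arr left h₁ (by omega), ← hp.arr right (by omega) h₃,
    show left + 1 + d = left + d + 1 by ring, show right - 1 + d = right + d - 1 by ring] at ho
  simp only [DualPivotQuicksort.partitionStep] at hb ⊢
  generalize DualPivotQuicksort.outerLoop
    ((DualPivotQuicksort.orderPivots left right s).arr left)
    ((DualPivotQuicksort.orderPivots left right s).arr right) (left + 1) _ _ _ = r at ho hb ⊢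
  generalize DualPivotQuicksort.outerLoop
    ((DualPivotQuicksort.orderPivots (left + d) (right + d) s').arr (left + d))
    ((DualPivotQuicksort.orderPivots (left + d) (right + d) s').arr (right + d)) (left + d + 1)
    _ _ _ = r' at ho ⊢
  obtain ⟨l', g', t⟩ := r'
  obtain ⟨rfl, rfl, ho⟩ := ho
  simp only
  rw [show r.1 + d - 1 = r.1 - 1 + d by ring, show r.2.1 + d + 1 = r.2.1 + 1 + d by ring]
  exact ⟨rfl, rfl, (ho.swap h₁ (by omega) (by omega) (by omega)).swap (by omega) h₃
    (by omega) (by omega)⟩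

/-- In the recursion any entry may become a pivot, so here `f` must be strictly monotone. This is
applied to the identity (independence of the rest of the state) and to translations of values
(reduction of a block to an initial segment). -/
theorem quicksort (hf : StrictMonoOn f S) {left right : ℤ} (h : Sim f S lo hi d c w s s')
    (h₁ : lo ≤ left) (h₃ : right ≤ hi) :
    Sim f S lo hi d c w (quicksort left right s)
      (quicksort (left + d) (right + d) s') := by
  have hR : ∀ x ∈ S, Respects f S x := fun x hx y hy =>
    ⟨hf.lt_iff_lt hy hx, hf.lt_iff_lt hx hy⟩
  fun_induction DualPivotQuicksort.quicksort left right s generalizing s' with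
  | case1 left right s hlt r s₁ s₂ ih₁ =>
    rename_i ih₂ ih₃
    have hb : left ≤ r.1 ∧ r.1 ≤ r.2.1 ∧ r.2.1 ≤ right :=
      partitionStep_bounds left right s hlt
    have hP : _ = r.1 + d ∧ _ = r.2.1 + d ∧ Sim f S lo hi d c w r.2.2 _ :=
      h.partitionStep (hR _ (h.mem left h₁ (by omega))) (hR _ (h.mem right (by omega) h₃))
        h₁ (by omega) h₃ hlt
    rw [DualPivotQuicksort.quicksort.eq_def (left + d), dif_pos (by omega)]
    generalize DualPivotQuicksort.partitionStep (left + d) (right + d) s' = r' at hP ⊢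
    obtain ⟨l', g', t⟩ := r'
    obtain ⟨rfl, rfl, hP⟩ := hP
    simp only
    rw [show r.1 + d - 1 = r.1 - 1 + d by ring, show r.1 + d + 1 = r.1 + 1 + d by ring,
      show r.2.1 + d - 1 = r.2.1 - 1 + d by ring, show r.2.1 + d + 1 = r.2.1 + 1 + d by ring]
    have e₁ : (DualPivotQuicksort.partitionStep left right s).1 = r.1 := rfl
    have e₂ : (DualPivotQuicksort.partitionStep left right s).2.1 = r.2.1 := rfl
    exact ih₃ (ih₂ (ih₁ hP h₁ (by omega)) (by omega) (by omega)) (by omega) h₃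
  | case2 left right s hlt =>
    rw [DualPivotQuicksort.quicksort, dif_neg (by omega)]
    exact h

end Sim

/-! ### Rearrangement of entries and the basic loop invariants -/

/-- The array `b` arises from `a` by permuting the entries at the positions `lo, …, hi`. -/
def IsRearrangement {α : Type*} (lo hi : ℤ) (a b : ℤ → α) : Prop :=
  ∃ τ : Equiv.Perm ℤ, (∀ i, i < lo ∨ hi < i → τ i = i) ∧ b = a ∘ τ

namespace IsRearrangement

variable {α : Type*} {lo hi : ℤ} {a b c : ℤ → α}

theorem refl (lo hi : ℤ) (a : ℤ → α) : IsRearrangement lo hi a a :=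
  ⟨1, fun _ _ => rfl, rfl⟩

theorem trans (h₁ : IsRearrangement lo hi a b) (h₂ : IsRearrangement lo hi b c) :
    IsRearrangement lo hi a c := by
  obtain ⟨τ, hτ, rfl⟩ := h₁
  obtain ⟨υ, hυ, rfl⟩ := h₂
  exact ⟨τ * υ, fun i hi => by rw [Equiv.Perm.mul_apply, hυ i hi, hτ i hi], rfl⟩

theorem swap (s : State α) {i j : ℤ} (hi₁ : lo ≤ i) (hi₂ : i ≤ hi) (hj₁ : lo ≤ j)
    (hj₂ : j ≤ hi) : IsRearrangement lo hi s.arr (s.swap i j).arr :=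
  ⟨Equiv.swap i j, fun _ hx => Equiv.swap_apply_of_ne_of_ne (by omega) (by omega), rfl⟩

theorem mono {lo' hi' : ℤ} (h : IsRearrangement lo hi a b) (hlo : lo' ≤ lo) (hhi : hi ≤ hi') :
    IsRearrangement lo' hi' a b := by
  obtain ⟨τ, hτ, rfl⟩ := h
  exact ⟨τ, fun i hi => hτ i (by omega), rfl⟩

theorem apply_eq (h : IsRearrangement lo hi a b) {i : ℤ} (hi : i < lo ∨ hi < i) :
    b i = a i := by
  obtain ⟨τ, hτ, rfl⟩ := h
  rw [Function.comp_apply, hτ i hi]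

theorem exists_perm (h : IsRearrangement lo hi a b) :
    ∃ τ : Equiv.Perm ℤ, (∀ i, lo ≤ i → i ≤ hi → lo ≤ τ i ∧ τ i ≤ hi) ∧ b = a ∘ τ := by
  obtain ⟨τ, hτ, rfl⟩ := h
  refine ⟨τ, fun i h₁ h₂ => ?_, rfl⟩
  by_contra hc
  have := τ.injective (hτ (τ i) (by omega))
  omega

end IsRearrangement

theorem swap_arr_of_ne {α : Type*} (s : State α) {i j x : ℤ} (hi : x ≠ i) (hj : x ≠ j) :
    (s.swap i j).arr x = s.arr x := by
  simp [State.swap, Equiv.swap_apply_of_ne_of_ne hi hj]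

theorem swap_arr_left {α : Type*} (s : State α) (i j : ℤ) : (s.swap i j).arr i = s.arr j := by
  simp [State.swap]

theorem swap_arr_right {α : Type*} (s : State α) (i j : ℤ) : (s.swap i j).arr j = s.arr i := by
  simp [State.swap]

section Specification

variable {α : Type*} [LinearOrder α]

/-- Every evaluation of the condition costs one comparison and all but the last decrement the
pointer, so comparisons plus pointer increase by exactly one. If the loop stops with `k` below the
pointer, it is the key test that failed. -/
theorem innerLoop_spec (q : α) {k g : ℤ} (s : State α) (hkg : k ≤ g) :
    (innerLoop q k g s).2.arr = s.arr ∧ (innerLoop q k g s).2.swaps = s.swaps ∧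
    ((innerLoop q k g s).2.comparisons : ℤ) + (innerLoop q k g s).1 =
      s.comparisons + g + 1 ∧
    (∀ i, (innerLoop q k g s).1 < i → i ≤ g → q < s.arr i) ∧
    (k < (innerLoop q k g s).1 → s.arr (innerLoop q k g s).1 ≤ q) := by
  fun_induction innerLoop q k g s with
  | case1 g s h ih =>
    obtain ⟨i₁, i₂, i₃, i₄, i₅⟩ := ih (by omega)
    simp only [State.tick] at *
    refine ⟨i₁, i₂, by push_cast at i₃; omega, fun i hi₁ hi₂ => ?_, i₅⟩
    rcases eq_or_lt_of_le hi₂ with rfl | hi₂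
    · exact h.1
    · exact i₄ i hi₁ (by omega)
  | case2 g s h =>
    simp only [State.tick]
    refine ⟨trivial, trivial, by push_cast; ring, fun i _ _ => by omega, fun hk => ?_⟩
    by_contra hc
    exact h ⟨not_le.1 hc, hk⟩

theorem le_outerLoop_snd (p q : α) (l g k : ℤ) (s : State α) (hkg : k ≤ g + 1) :
    k - 1 ≤ (outerLoop p q l g k s).2.1 := by
  fun_induction outerLoop p q l g k s with
  | case1 l g k s h s₁ h₁ ih => have := ih (by omega); omega
  | case2 l g k s h s₁ h₁ s₂ h₂ r s₃ h₃ ih =>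
    have hr' : k ≤ r.1 := le_innerLoop_fst q k g s₂ h
    rcases eq_or_lt_of_le hr' with e | hr'
    -- The pointers met: after the updates they are `k + 1` and `k - 1`, so the hypothesis `k ≤ g +
    -- 1` is lost and the induction hypothesis does not apply. The loop is over, and one unfolding
    -- suffices.
    · rw [outerLoop, dif_neg (by omega)]
      change k - 1 ≤ r.1 - 1
      omega
    · have := ih (by omega); omega
  | case3 l g k s h s₁ h₁ s₂ h₂ r s₃ h₃ ih =>
    have hr' : k ≤ r.1 := le_innerLoop_fst q k g s₂ h
    rcases eq_or_lt_of_le hr' with e | hr'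
    · rw [outerLoop, dif_neg (by omega)]
      change k - 1 ≤ r.1 - 1
      omega
    · have := ih (by omega); omega
  | case4 l g k s h s₁ h₁ s₂ h₂ ih => have := ih (by omega); omega
  | case5 l g k s h => simp only; omega

theorem outerLoop_isRearrangement (p q : α) {lo hi l g k : ℤ} (s : State α) (hl : lo ≤ l)
    (hlk : l ≤ k) (hg : g ≤ hi) :
    IsRearrangement lo hi s.arr (outerLoop p q l g k s).2.2.arr := by
  fun_induction outerLoop p q l g k s with
  | case1 l g k s h s₁ h₁ ih =>
    exact .trans (.swap s₁ (by omega) (by omega) (by omega) (by omega))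
      (ih (by omega) (by omega) hg)
  | case2 l g k s h s₁ h₁ s₂ h₂ r s₃ h₃ ih =>
    have hr : r.1 ≤ g := innerLoop_fst_le q k g s₂
    have hr' : k ≤ r.1 := le_innerLoop_fst q k g s₂ h
    have ha : r.2.arr = s.arr := (innerLoop_spec q s₂ h).1
    rw [← ha]
    exact .trans (.swap r.2 (by omega) (by omega) (by omega) (by omega))
      (.trans (.swap s₃ (by omega) (by omega) (by omega) (by omega))
        (ih (by omega) (by omega) (by omega)))
  | case3 l g k s h s₁ h₁ s₂ h₂ r s₃ h₃ ih =>
    have hr : r.1 ≤ g := innerLoop_fst_le q k g s₂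
    have hr' : k ≤ r.1 := le_innerLoop_fst q k g s₂ h
    have ha : r.2.arr = s.arr := (innerLoop_spec q s₂ h).1
    rw [← ha]
    exact .trans (.swap r.2 (by omega) (by omega) (by omega) (by omega))
        (ih (by omega) (by omega) (by omega))
  | case4 l g k s h s₁ h₁ s₂ h₂ ih => exact ih hl (by omega) hg
  | case5 l g k s h => exact .refl _ _ _

theorem partitionStep_isRearrangement {left right : ℤ} (s : State α) (h : 1 ≤ right - left) :
    IsRearrangement left right s.arr (partitionStep left right s).2.2.arr := by
  have hb := partitionStep_bounds left right s h
  have h₀ : IsRearrangement left right s.arr (orderPivots left right s).arr := by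
    unfold orderPivots
    split_ifs
    · exact .swap s.tick (by omega) (by omega) (by omega) (by omega)
    · exact .refl _ _ _
  simp only [partitionStep] at hb ⊢
  exact h₀.trans (.trans (outerLoop_isRearrangement _ _ _ (by omega) le_rfl (by omega))
    (.trans (.swap _ (by omega) (by omega) (by omega) (by omega))
      (.swap _ (by omega) (by omega) (by omega) (by omega))))

theorem quicksort_isRearrangement (left right : ℤ) (s : State α) :
    IsRearrangement left right s.arr (quicksort left right s).arr := by
  fun_induction quicksort left right s with
  | case1 left right s h r s₁ s₂ ih₁ _ ih₂ =>
    rename_i ih₃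
    have hb : left ≤ r.1 ∧ r.1 ≤ r.2.1 ∧ r.2.1 ≤ right :=
      partitionStep_bounds left right s h
    have h₁ : IsRearrangement left right r.2.2.arr s₁.arr :=
      ih₁.mono (hi := r.1 - 1) le_rfl (by omega)
    have h₂ : IsRearrangement left right s₁.arr s₂.arr :=
      ih₂.mono (lo := r.1 + 1) (hi := r.2.1 - 1) (by omega) (by omega)
    exact (partitionStep_isRearrangement s h).trans <| h₁.trans <|
      h₂.trans (ih₃.mono (lo := r.2.1 + 1) (by omega) le_rfl)
  | case2 left right s h => exact .refl _ _ _

end Specification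

end DualPivotQuicksort

/-! ### Partition zones and exact cost of the outer loop -/

namespace DualPivotQuicksort

theorem State.swap_arr_apply {α : Type*} (s : State α) (i j x : ℤ) :
    (s.swap i j).arr x = if x = i then s.arr j else if x = j then s.arr i else s.arr x := by
  simp only [State.swap, Function.comp_apply, Equiv.swap_apply_def]
  split_ifs <;> rfl

theorem sum_Icc_eq_add_sum_Icc (f : ℤ → ℤ) {a b : ℤ} (h : a ≤ b) :
    ∑ i ∈ Finset.Icc a b, f i = f a + ∑ i ∈ Finset.Icc (a + 1) b, f i := by
  have e : Finset.Icc a b = insert a (Finset.Icc (a + 1) b) := by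
    ext x
    simp only [Finset.mem_Icc, Finset.mem_insert]
    omega
  rw [e, Finset.sum_insert (by simp)]

theorem sum_Icc_eq_sum_Icc_add (f : ℤ → ℤ) {a m b : ℤ} (h₁ : a ≤ m) (h₂ : m ≤ b) :
    ∑ i ∈ Finset.Icc a b, f i =
      ∑ i ∈ Finset.Icc a (m - 1), f i + f m + ∑ i ∈ Finset.Icc (m + 1) b, f i := by
  have e : Finset.Icc a b = Finset.Icc a (m - 1) ∪ Finset.Icc m b := by
    ext x
    simp only [Finset.mem_Icc, Finset.mem_union]
    omega
  rw [e, Finset.sum_union, sum_Icc_eq_add_sum_Icc f h₂, add_assoc]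
  rw [Finset.disjoint_left]
  intro x
  simp only [Finset.mem_Icc]
  omega

/-- The number of key comparisons of the outer loop, started with the pointers `k` and `g` and
ending with `g'`, where `S` and `L` are the indicators of the positions of small and of large
elements. -/
noncomputable def loopComparisons (S L : ℤ → ℤ) (k g g' : ℤ) : ℤ :=
  g - k + 1 + ∑ i ∈ Finset.Icc k g', (1 - S i + L i) + 3 * if g' < g then L (g' + 1) else 0

/-- The number of swaps of the outer loop, started with the pointers `k` and `g` and
ending with `g'`, where `S` and `L` are the indicators of the positions of small and of large
elements. -/
noncomputable def loopSwaps (S L : ℤ → ℤ) (k g g' : ℤ) : ℤ :=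
  ∑ i ∈ Finset.Icc k g, S i + ∑ i ∈ Finset.Icc k g', L i + if g' < g then L (g' + 1) else 0

section LoopCost

variable {S L S' L' : ℤ → ℤ} {k g g' r : ℤ}

theorem loopComparisons_congr (hS : ∀ i, k ≤ i → i ≤ g → S i = S' i)
    (hL : ∀ i, k ≤ i → i ≤ g → L i = L' i) (hk : k ≤ g' + 1) (hg : g' ≤ g) :
    loopComparisons S L k g g' = loopComparisons S' L' k g g' := by
  unfold loopComparisons
  congr 2
  · refine Finset.sum_congr rfl fun i hi => ?_
    rw [Finset.mem_Icc] at hi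
    rw [hS i hi.1 (by omega), hL i hi.1 (by omega)]
  · split_ifs with h
    · exact hL _ hk (by omega)
    · rfl

theorem loopSwaps_congr (hS : ∀ i, k ≤ i → i ≤ g → S i = S' i)
    (hL : ∀ i, k ≤ i → i ≤ g → L i = L' i) (hk : k ≤ g' + 1) (hg : g' ≤ g) :
    loopSwaps S L k g g' = loopSwaps S' L' k g g' := by
  unfold loopSwaps
  refine congrArg₂ (· + ·) (congrArg₂ (· + ·) ?_ ?_) ?_
  · refine Finset.sum_congr rfl fun i hi => ?_
    rw [Finset.mem_Icc] at hi
    exact hS i hi.1 hi.2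
  · refine Finset.sum_congr rfl fun i hi => ?_
    rw [Finset.mem_Icc] at hi
    exact hL i hi.1 (by omega)
  · split_ifs with h
    · exact hL _ hk (by omega)
    · rfl

theorem loopComparisons_succ_left (hk : k ≤ g') :
    loopComparisons S L k g g' = 2 - S k + L k + loopComparisons S L (k + 1) g g' := by
  unfold loopComparisons
  rw [sum_Icc_eq_add_sum_Icc _ hk]
  ring

theorem loopSwaps_succ_left (hk : k ≤ g') (hg : g' ≤ g) :
    loopSwaps S L k g g' = S k + L k + loopSwaps S L (k + 1) g g' := by
  unfold loopSwaps
  rw [sum_Icc_eq_add_sum_Icc _ hk, sum_Icc_eq_add_sum_Icc _ (hk.trans hg)]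
  ring

/-- This accounts for an inner loop that moves `g` down to `r`, at one comparison per visited
position. Since `r` is not large, the boundary term is unaffected even when `g' = r - 1`. -/
theorem loopComparisons_shrink (hr : g' < r) (hrg : r ≤ g) (hL : L r = 0) :
    loopComparisons S L k g g' = g - r + 1 + loopComparisons S L k (r - 1) g' := by
  unfold loopComparisons
  rw [if_pos (by omega)]
  rcases eq_or_lt_of_le (show g' ≤ r - 1 by omega) with h | h
  · rw [if_neg (by omega), show g' + 1 = r by omega, hL]
    ring
  · rw [if_pos h]
    ring

theorem loopSwaps_shrink (hkr : k ≤ r) (hr : g' < r) (hrg : r ≤ g) (hL : L r = 0)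
    (hS : ∀ i, r < i → i ≤ g → S i = 0) :
    loopSwaps S L k g g' = S r + loopSwaps S L k (r - 1) g' := by
  unfold loopSwaps
  rw [if_pos (by omega), sum_Icc_eq_sum_Icc_add S hkr hrg, Finset.sum_eq_zero (s := .Icc (r + 1) g)
    fun i hi => hS i (by rw [Finset.mem_Icc] at hi; omega) (by rw [Finset.mem_Icc] at hi; omega)]
  rcases eq_or_lt_of_le (show g' ≤ r - 1 by omega) with h | h
  · rw [if_neg (by omega), show g' + 1 = r by omega, hL]
    ring
  · rw [if_pos h]
    ring

end LoopCost

/-- The indicator of `x < p`. -/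
def smallInd {α : Type*} [LinearOrder α] (p x : α) : ℤ := if x < p then 1 else 0

/-- The indicator of `q < x`. -/
def largeInd {α : Type*} [LinearOrder α] (q x : α) : ℤ := if q < x then 1 else 0

section Specification

variable {α : Type*} [LinearOrder α]

/-- The loop invariant: small entries on `[lo, l)`, medium ones on `[l, k)`, large ones on `(g,
hi]`, with `[k, g]` still unseen. -/
theorem outerLoop_zones {p q : α} (hpq : p ≤ q) {lo hi l g k : ℤ} (s : State α)
    (hl : lo ≤ l) (hlk : l ≤ k) (hkg : k ≤ g + 1) (hg : g ≤ hi)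
    (hs : ∀ i, lo ≤ i → i < l → s.arr i < p)
    (hm : ∀ i, l ≤ i → i < k → p ≤ s.arr i ∧ s.arr i ≤ q)
    (hL : ∀ i, g < i → i ≤ hi → q < s.arr i) :
    (∀ i, lo ≤ i → i < (outerLoop p q l g k s).1 → (outerLoop p q l g k s).2.2.arr i < p) ∧
    (∀ i, (outerLoop p q l g k s).1 ≤ i → i ≤ (outerLoop p q l g k s).2.1 →
      p ≤ (outerLoop p q l g k s).2.2.arr i ∧ (outerLoop p q l g k s).2.2.arr i ≤ q) ∧
    (∀ i, (outerLoop p q l g k s).2.1 < i → i ≤ hi →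
      q < (outerLoop p q l g k s).2.2.arr i) := by
  fun_induction outerLoop p q l g k s with
  | case1 l g k s h s₁ h₁ ih =>
    have e : s₁.arr = s.arr := rfl
    refine ih (by omega) (by omega) (by omega) hg (fun i hi₁ hi₂ => ?_) (fun i hi₁ hi₂ => ?_)
      (fun i hi₁ hi₂ => ?_) <;> rw [State.swap_arr_apply]
    · split_ifs with c₁ c₂
      · rw [e]
        rcases eq_or_lt_of_le hlk with rfl | hlk
        · exact h₁
        · omega
      · exact h₁
      · exact hs i hi₁ (by omega)
    · split_ifs with c₁ c₂
      · exact hm l le_rfl (by omega)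
      · omega
      · exact hm i (by omega) (by omega)
    · rw [if_neg (by omega), if_neg (by omega)]
      exact hL i hi₁ hi₂
  | case2 l g k s h s₁ h₁ s₂ h₂ r s₃ h₃ ih =>
    have hr : r.1 ≤ g := innerLoop_fst_le q k g s₂
    have hr' : k ≤ r.1 := le_innerLoop_fst q k g s₂ h
    have hsp : r.2.arr = s.arr ∧ _ := innerLoop_spec q s₂ h
    obtain ⟨e, -, -, hS₁, hS₂⟩ := hsp
    have e₃ : ∀ x, s₃.arr x = if x = k then s.arr r.1 else if x = r.1 then s.arr k
        else s.arr x := fun x => by rw [← e]; exact State.swap_arr_apply r.2 k r.1 x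
    change q < s.arr k at h₂
    have hk₃ : s₃.arr k = s.arr r.1 := by rw [e₃, if_pos rfl]
    -- If the inner loop came down to `k`, the entry is swapped with itself and would be both above
    -- `q` and below `p`.
    rcases eq_or_lt_of_le hr' with er | hr'
    · rw [hk₃, ← er] at h₃
      exact absurd (h₂.trans h₃) (not_lt.2 hpq)
    · refine ih (by omega) (by omega) (by omega) (by omega) (fun i hi₁ hi₂ => ?_)
        (fun i hi₁ hi₂ => ?_) (fun i hi₁ hi₂ => ?_) <;> rw [State.swap_arr_apply]
      · split_ifs with c₁ c₂
        · rcases eq_or_lt_of_le hlk with rfl | hlk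
          · exact h₃
          · omega
        · exact h₃
        · rw [e₃, if_neg c₁, if_neg (by omega)]
          exact hs i hi₁ (by omega)
      · split_ifs with c₁ c₂
        · rw [e₃, if_neg (by omega), if_neg (by omega)]
          exact hm l le_rfl (by omega)
        · omega
        · rw [e₃, if_neg c₁, if_neg (by omega)]
          exact hm i (by omega) (by omega)
      · rw [if_neg (by omega), if_neg (by omega), e₃, if_neg (by omega)]
        split_ifs with c₁
        · exact h₂
        · rcases le_or_gt i g with hig | hig
          · exact hS₁ i (show r.1 < i by omega) hig
          · exact hL i hig hi₂
  | case3 l g k s h s₁ h₁ s₂ h₂ r s₃ h₃ ih =>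
    have hr : r.1 ≤ g := innerLoop_fst_le q k g s₂
    have hr' : k ≤ r.1 := le_innerLoop_fst q k g s₂ h
    have hsp : r.2.arr = s.arr ∧ _ := innerLoop_spec q s₂ h
    obtain ⟨e, -, -, hS₁, hS₂⟩ := hsp
    have e₃ : ∀ x, s₃.arr x = if x = k then s.arr r.1 else if x = r.1 then s.arr k
        else s.arr x := fun x => by rw [← e]; exact State.swap_arr_apply r.2 k r.1 x
    change q < s.arr k at h₂
    have hk₃ : s₃.arr k = s.arr r.1 := by rw [e₃, if_pos rfl]
    have hL' : ∀ i, r.1 - 1 < i → i ≤ hi → i ≠ k ∨ r.1 = k → q < s₃.arr i := by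
      intro i hi₁ hi₂ hi₃
      rw [e₃]
      split_ifs with c₁ c₂
      · rcases hi₃ with hi₃ | hi₃
        · exact absurd c₁ hi₃
        · rwa [hi₃]
      · exact h₂
      · rcases le_or_gt i g with hig | hig
        · exact hS₁ i (show r.1 < i by omega) hig
        · exact hL i hig hi₂
    rcases eq_or_lt_of_le hr' with er | hr'
    · rw [outerLoop, dif_neg (by omega)]
      refine ⟨fun i hi₁ hi₂ => ?_, fun i hi₁ hi₂ => ?_, fun i hi₁ hi₂ => ?_⟩
      · simp only at hi₂ ⊢
        rw [e₃, if_neg (by omega), if_neg (by omega)]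
        exact hs i hi₁ hi₂
      · simp only at hi₁ hi₂ ⊢
        rw [e₃, if_neg (by omega), if_neg (by omega)]
        exact hm i hi₁ (by omega)
      · exact hL' i hi₁ hi₂ (.inr er.symm)
    · refine ih (by omega) (by omega) (by omega) (by omega) (fun i hi₁ hi₂ => ?_)
        (fun i hi₁ hi₂ => ?_) (fun i hi₁ hi₂ => hL' i hi₁ hi₂ (by omega))
      · rw [e₃, if_neg (by omega), if_neg (by omega)]
        exact hs i hi₁ hi₂
      · rcases eq_or_ne i k with rfl | hik
        · rw [hk₃]
          rw [hk₃] at h₃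
          exact ⟨not_lt.1 h₃, hS₂ hr'⟩
        · rw [e₃, if_neg hik, if_neg (by omega)]
          exact hm i hi₁ (by omega)
  | case4 l g k s h s₁ h₁ s₂ h₂ ih =>
    refine ih hl (by omega) (by omega) hg hs (fun i hi₁ hi₂ => ?_) hL
    rcases eq_or_ne i k with rfl | hik
    · exact ⟨not_lt.1 h₁, not_lt.1 h₂⟩
    · exact hm i hi₁ (by omega)
  | case5 l g k s h => exact ⟨hs, fun i hi₁ hi₂ => hm i hi₁ (by simp only at hi₂; omega), hL⟩

/-- Unseen entries keep their original places, so indicators of the initial array suffice. A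
position passed by `k` costs one test `A[k] < p`, a second test unless it is small, and a third
after the exchange if it is large; a position passed by `g` costs one test. The passed positions
together make up `[k, g]`, except that `k` may also reach `g' + 1`. This happens exactly when that
entry, taken by `g`, is large, and adds three tests. For swaps: each small entry moves left once,
and each large entry met by `k` is exchanged once. -/
theorem outerLoop_cost {p q : α} (hpq : p ≤ q) {l g k : ℤ} (s : State α) (hlk : l ≤ k)
    (hkg : k ≤ g + 1) :
    ((outerLoop p q l g k s).2.2.comparisons : ℤ) = s.comparisons +
      loopComparisons (fun i => smallInd p (s.arr i)) (fun i => largeInd q (s.arr i)) k g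
        (outerLoop p q l g k s).2.1 ∧
    ((outerLoop p q l g k s).2.2.swaps : ℤ) = s.swaps +
      loopSwaps (fun i => smallInd p (s.arr i)) (fun i => largeInd q (s.arr i)) k g
        (outerLoop p q l g k s).2.1 := by
  fun_induction outerLoop p q l g k s with
  | case1 l g k s h s₁ h₁ ih =>
    have hb := le_outerLoop_snd p q (l + 1) g (k + 1) (s₁.swap k l) (by omega)
    have hb' := (outerLoop_bounds p q (l + 1) g (k + 1) (s₁.swap k l) (by omega) (by omega)).2.2
    obtain ⟨i₁, i₂⟩ := ih (by omega) (by omega)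
    generalize outerLoop p q (l + 1) g (k + 1) (s₁.swap k l) = t at *
    change s.arr k < p at h₁
    have hx : ∀ x, k + 1 ≤ x → (s₁.swap k l).arr x = s.arr x := fun x hx =>
      swap_arr_of_ne s₁ (by omega) (by omega)
    have hSk : smallInd p (s.arr k) = 1 := if_pos h₁
    have hLk : largeInd q (s.arr k) = 0 := if_neg (not_lt.2 (h₁.le.trans hpq))
    rw [loopComparisons_congr (fun i hi₁ _ => congrArg (smallInd p) (hx i hi₁))
      (fun i hi₁ _ => congrArg (largeInd q) (hx i hi₁)) (by omega) hb'] at i₁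
    rw [loopSwaps_congr (fun i hi₁ _ => congrArg (smallInd p) (hx i hi₁))
      (fun i hi₁ _ => congrArg (largeInd q) (hx i hi₁)) (by omega) hb'] at i₂
    have hc : (s₁.swap k l).comparisons = s.comparisons + 1 := rfl
    have hw : (s₁.swap k l).swaps = s.swaps + 1 := rfl
    rw [loopComparisons_succ_left (by omega), loopSwaps_succ_left (by omega) hb', i₁, i₂, hSk, hLk,
      hc, hw]
    constructor <;> push_cast <;> ring
  | case2 l g k s h s₁ h₁ s₂ h₂ r s₃ h₃ ih =>
    have hr : r.1 ≤ g := innerLoop_fst_le q k g s₂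
    have hr' : k ≤ r.1 := le_innerLoop_fst q k g s₂ h
    have hsp : r.2.arr = s.arr ∧ r.2.swaps = s.swaps ∧
      (r.2.comparisons : ℤ) + r.1 = ((s.comparisons + 1 + 1 : ℕ) : ℤ) + g + 1 ∧ _ :=
      innerLoop_spec q s₂ h
    obtain ⟨e, hsw, hcm, hS₁, hS₂⟩ := hsp
    have e₃ : ∀ x, s₃.arr x = if x = k then s.arr r.1 else if x = r.1 then s.arr k
        else s.arr x := fun x => by rw [← e]; exact State.swap_arr_apply r.2 k r.1 x
    change q < s.arr k at h₂
    change ¬ s.arr k < p at h₁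
    have hk₃ : s₃.arr k = s.arr r.1 := by rw [e₃, if_pos rfl]
    rw [hk₃] at h₃
    have hc₃ : s₃.comparisons = r.2.comparisons + 1 := rfl
    have hw₃ : s₃.swaps = r.2.swaps + 1 := rfl
    rcases eq_or_lt_of_le hr' with er | hr'
    · rw [← er] at h₃
      exact absurd h₃ h₁
    · have hb := le_outerLoop_snd p q (l + 1) (r.1 - 1) (k + 1) (s₃.swap k l) (by omega)
      have hb' := (outerLoop_bounds p q (l + 1) (r.1 - 1) (k + 1) (s₃.swap k l) (by omega) (by omega)).2.2
      obtain ⟨i₁, i₂⟩ := ih (by omega) (by omega)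
      generalize outerLoop p q (l + 1) (r.1 - 1) (k + 1) (s₃.swap k l) = t at *
      have hx : ∀ x, k + 1 ≤ x → x ≤ r.1 - 1 → (s₃.swap k l).arr x = s.arr x := fun x hx₁ hx₂ => by
        rw [swap_arr_of_ne s₃ (by omega) (by omega), e₃, if_neg (by omega), if_neg (by omega)]
      have hSr : smallInd p (s.arr r.1) = 1 := if_pos h₃
      have hSk : smallInd p (s.arr k) = 0 := if_neg h₁
      have hLk : largeInd q (s.arr k) = 1 := if_pos h₂
      have hLr : largeInd q (s.arr r.1) = 0 := if_neg (not_lt.2 (hS₂ hr'))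
      rw [loopComparisons_congr (fun i hi₁ hi₂ => congrArg (smallInd p) (hx i hi₁ hi₂))
        (fun i hi₁ hi₂ => congrArg (largeInd q) (hx i hi₁ hi₂)) (by omega) hb'] at i₁
      rw [loopSwaps_congr (fun i hi₁ hi₂ => congrArg (smallInd p) (hx i hi₁ hi₂))
        (fun i hi₁ hi₂ => congrArg (largeInd q) (hx i hi₁ hi₂)) (by omega) hb'] at i₂
      rw [loopComparisons_succ_left (by omega), loopSwaps_succ_left (by omega) (by omega),
        loopComparisons_shrink (r := r.1) (L := fun i => largeInd q (s.arr i)) (by omega) hr hLr,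
        loopSwaps_shrink (r := r.1) (S := fun i => smallInd p (s.arr i))
          (L := fun i => largeInd q (s.arr i)) (by omega) (by omega) hr hLr fun i hi₁ hi₂ =>
          if_neg (not_lt.2 (hpq.trans (hS₁ i hi₁ hi₂).le)), hSr, hSk, hLk, i₁, i₂]
      have hc₄ : (s₃.swap k l).comparisons = s₃.comparisons := rfl
      have hw₄ : (s₃.swap k l).swaps = s₃.swaps + 1 := rfl
      constructor <;> push_cast [*] at * <;> omega
  | case3 l g k s h s₁ h₁ s₂ h₂ r s₃ h₃ ih =>
    have hr : r.1 ≤ g := innerLoop_fst_le q k g s₂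
    have hr' : k ≤ r.1 := le_innerLoop_fst q k g s₂ h
    have hsp : r.2.arr = s.arr ∧ r.2.swaps = s.swaps ∧
      (r.2.comparisons : ℤ) + r.1 = ((s.comparisons + 1 + 1 : ℕ) : ℤ) + g + 1 ∧ _ :=
      innerLoop_spec q s₂ h
    obtain ⟨e, hsw, hcm, hS₁, hS₂⟩ := hsp
    have e₃ : ∀ x, s₃.arr x = if x = k then s.arr r.1 else if x = r.1 then s.arr k
        else s.arr x := fun x => by rw [← e]; exact State.swap_arr_apply r.2 k r.1 x
    change q < s.arr k at h₂
    change ¬ s.arr k < p at h₁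
    have hk₃ : s₃.arr k = s.arr r.1 := by rw [e₃, if_pos rfl]
    rw [hk₃] at h₃
    have hc₃ : s₃.comparisons = r.2.comparisons + 1 := rfl
    have hw₃ : s₃.swaps = r.2.swaps + 1 := rfl
    rcases eq_or_lt_of_le hr' with er | hr'
    · rw [outerLoop, dif_neg (by omega)]
      -- Here `k` has met `g` on a large entry and everything above it up to `g` is large too, so
      -- only the pointer term and the boundary term survive.
      have hz : ∀ i ∈ Finset.Icc k g, smallInd p (s.arr i) = 0 := fun i hi => by
        rw [Finset.mem_Icc] at hi
        have : q < s.arr i := by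
          rcases eq_or_lt_of_le hi.1 with rfl | hki
          · exact h₂
          · exact hS₁ i (show r.1 < i by omega) hi.2
        exact if_neg (not_lt.2 (hpq.trans this.le))
      have hk1 : largeInd q (s.arr k) = 1 := if_pos h₂
      simp only [loopComparisons, loopSwaps, Finset.sum_eq_zero hz]
      rw [Finset.Icc_eq_empty (by omega), Finset.sum_empty, Finset.sum_empty, if_pos (by omega),
        ← er, sub_add_cancel, hk1]
      omega
    · have hb := le_outerLoop_snd p q l (r.1 - 1) (k + 1) s₃ (by omega)
      have hb' := (outerLoop_bounds p q l (r.1 - 1) (k + 1) s₃ (by omega) (by omega)).2.2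
      obtain ⟨i₁, i₂⟩ := ih (by omega) (by omega)
      generalize outerLoop p q l (r.1 - 1) (k + 1) s₃ = t at *
      have hx : ∀ x, k + 1 ≤ x → x ≤ r.1 - 1 → s₃.arr x = s.arr x := fun x hx₁ hx₂ => by
        rw [e₃, if_neg (by omega), if_neg (by omega)]
      have hSr : smallInd p (s.arr r.1) = 0 := if_neg h₃
      have hSk : smallInd p (s.arr k) = 0 := if_neg h₁
      have hLk : largeInd q (s.arr k) = 1 := if_pos h₂
      have hLr : largeInd q (s.arr r.1) = 0 := if_neg (not_lt.2 (hS₂ hr'))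
      rw [loopComparisons_congr (fun i hi₁ hi₂ => congrArg (smallInd p) (hx i hi₁ hi₂))
        (fun i hi₁ hi₂ => congrArg (largeInd q) (hx i hi₁ hi₂)) (by omega) hb'] at i₁
      rw [loopSwaps_congr (fun i hi₁ hi₂ => congrArg (smallInd p) (hx i hi₁ hi₂))
        (fun i hi₁ hi₂ => congrArg (largeInd q) (hx i hi₁ hi₂)) (by omega) hb'] at i₂
      rw [loopComparisons_succ_left (by omega), loopSwaps_succ_left (by omega) (by omega),
        loopComparisons_shrink (r := r.1) (L := fun i => largeInd q (s.arr i)) (by omega) hr hLr,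
        loopSwaps_shrink (r := r.1) (S := fun i => smallInd p (s.arr i))
          (L := fun i => largeInd q (s.arr i)) (by omega) (by omega) hr hLr fun i hi₁ hi₂ =>
          if_neg (not_lt.2 (hpq.trans (hS₁ i hi₁ hi₂).le)), hSr, hSk, hLk, i₁, i₂]
      constructor <;> push_cast [*] at * <;> omega
  | case4 l g k s h s₁ h₁ s₂ h₂ ih =>
    have hb := le_outerLoop_snd p q l g (k + 1) s₂ (by omega)
    have hb' := (outerLoop_bounds p q l g (k + 1) s₂ (by omega) (by omega)).2.2
    obtain ⟨i₁, i₂⟩ := ih (by omega) (by omega)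
    generalize outerLoop p q l g (k + 1) s₂ = t at *
    have hSk : smallInd p (s.arr k) = 0 := if_neg h₁
    have hLk : largeInd q (s.arr k) = 0 := if_neg h₂
    have hc : s₂.comparisons = s.comparisons + 1 + 1 := rfl
    have hw : s₂.swaps = s.swaps := rfl
    have ha : s₂.arr = s.arr := rfl
    rw [loopComparisons_succ_left (by omega), loopSwaps_succ_left (by omega) hb', i₁, i₂, hSk, hLk,
      hc, hw, ha]
    constructor <;> push_cast <;> ring
  | case5 l g k s h =>
    simp [loopComparisons, loopSwaps, show g = k - 1 by omega]


end Specification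

end DualPivotQuicksort

/-! ### Specification and cost of a partitioning step -/

namespace DualPivotQuicksort

section Specification

variable {α : Type*} [LinearOrder α]

theorem outerLoop_fst_le (p q : α) {l g k : ℤ} (s : State α) (hlk : l ≤ k) (hkg : k ≤ g + 1) :
    (outerLoop p q l g k s).1 ≤ g + 1 := by
  fun_induction outerLoop p q l g k s with
  | case1 l g k s h s₁ h₁ ih => exact ih (by omega) (by omega)
  | case2 l g k s h s₁ h₁ s₂ h₂ r s₃ h₃ ih =>
    have hr : r.1 ≤ g := innerLoop_fst_le q k g s₂
    have hr' : k ≤ r.1 := le_innerLoop_fst q k g s₂ h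
    rcases eq_or_lt_of_le hr' with e | hr'
    · rw [outerLoop, dif_neg (by omega)]
      change l + 1 ≤ g + 1
      omega
    · have := ih (by omega) (by omega)
      omega
  | case3 l g k s h s₁ h₁ s₂ h₂ r s₃ h₃ ih =>
    have hr : r.1 ≤ g := innerLoop_fst_le q k g s₂
    have hr' : k ≤ r.1 := le_innerLoop_fst q k g s₂ h
    rcases eq_or_lt_of_le hr' with e | hr'
    · rw [outerLoop, dif_neg (by omega)]
      change l ≤ g + 1
      omega
    · have := ih (by omega) (by omega)
      omega
  | case4 l g k s h s₁ h₁ s₂ h₂ ih => exact ih (by omega) (by omega)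
  | case5 l g k s h => exact hlk.trans hkg

variable {left right : ℤ} (s : State α)

theorem orderPivots_arr_left : (orderPivots left right s).arr left =
    min (s.arr left) (s.arr right) := by
  unfold orderPivots
  split_ifs with h
  · rw [swap_arr_left, min_eq_right h.le]
    rfl
  · rw [min_eq_left (not_lt.1 h)]
    rfl

theorem orderPivots_arr_right : (orderPivots left right s).arr right =
    max (s.arr left) (s.arr right) := by
  unfold orderPivots
  split_ifs with h
  · rw [swap_arr_right, max_eq_left h.le]
    rfl
  · rw [max_eq_right (not_lt.1 h)]
    rfl

theorem orderPivots_arr_of_lt {i : ℤ} (h₁ : left < i) (h₂ : i < right) :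
    (orderPivots left right s).arr i = s.arr i := by
  unfold orderPivots
  split_ifs with h
  · rw [swap_arr_of_ne _ (by omega) (by omega)]
    rfl
  · rfl

theorem orderPivots_comparisons : (orderPivots left right s).comparisons = s.comparisons + 1 := by
  unfold orderPivots
  split_ifs <;> rfl

theorem orderPivots_swaps : (orderPivots left right s).swaps =
    s.swaps + if s.arr right < s.arr left then 1 else 0 := by
  unfold orderPivots
  split_ifs <;> rfl

theorem partitionStep_zones (h : 1 ≤ right - left) (hne : s.arr left ≠ s.arr right) {p q : α}
    (hp : p = min (s.arr left) (s.arr right)) (hq : q = max (s.arr left) (s.arr right))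
    {r : ℤ × ℤ × State α} (hr : r = partitionStep left right s) :
    (left ≤ r.1 ∧ r.1 < r.2.1 ∧ r.2.1 ≤ right) ∧
    (∀ i, left ≤ i → i < r.1 → r.2.2.arr i < p) ∧
    (∀ i, r.1 ≤ i → i ≤ r.2.1 → p ≤ r.2.2.arr i ∧ r.2.2.arr i ≤ q) ∧
    r.2.2.arr r.1 = p ∧ r.2.2.arr r.2.1 = q ∧
    (∀ i, r.2.1 < i → i ≤ right → q < r.2.2.arr i) := by
  have hpq : p < q := by rw [hp, hq]; exact min_lt_max.2 hne
  simp only [partitionStep, orderPivots_arr_left, orderPivots_arr_right, ← hp, ← hq] at hr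
  obtain ⟨z₁, z₂, z₃⟩ := outerLoop_zones hpq.le (lo := left + 1) (hi := right - 1) (l := left + 1)
    (g := right - 1) (k := left + 1) (orderPivots left right s) le_rfl le_rfl (by omega) le_rfl
    (fun i _ _ => by omega) (fun i _ _ => by omega) (fun i _ _ => by omega)
  have b := outerLoop_bounds p q (left + 1) (right - 1) (left + 1) (orderPivots left right s)
    le_rfl (by omega)
  have b₁ := outerLoop_fst_le p q (l := left + 1) (g := right - 1) (k := left + 1)
    (orderPivots left right s) le_rfl (by omega)
  have b₂ := le_outerLoop_snd p q (left + 1) (right - 1) (left + 1) (orderPivots left right s)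
    (by omega)
  have hR := outerLoop_isRearrangement p q (lo := left + 1) (hi := right - 1) (l := left + 1)
    (g := right - 1) (k := left + 1) (orderPivots left right s) le_rfl le_rfl le_rfl
  have hl := hR.apply_eq (i := left) (by omega)
  have hg := hR.apply_eq (i := right) (by omega)
  rw [orderPivots_arr_left, ← hp] at hl
  rw [orderPivots_arr_right, ← hq] at hg
  generalize outerLoop p q (left + 1) (right - 1) (left + 1) (orderPivots left right s) = o at *
  obtain ⟨l, g, t⟩ := o
  subst hr
  simp only at *
  -- The small and large zones cannot overlap, since a common position would hold an entry both
  -- below `p` and above `q`.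
  have hlg : l ≤ g + 1 := by
    by_contra hc
    have h₁ := z₁ (g + 1) (by omega) (by omega)
    have h₂ := z₃ (g + 1) (by omega) (by omega)
    exact lt_asymm hpq (h₂.trans h₁)
  have hT : ∀ i, ((t.swap left (l - 1)).swap right (g + 1)).arr i =
      if i = right then (if g + 1 = left then t.arr (l - 1) else if g + 1 = l - 1 then t.arr left
        else t.arr (g + 1)) else if i = g + 1 then t.arr right else
        if i = left then t.arr (l - 1) else if i = l - 1 then t.arr left else t.arr i := by
    intro i
    rw [State.swap_arr_apply, State.swap_arr_apply, State.swap_arr_apply, State.swap_arr_apply,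
      if_neg (show right ≠ left by omega), if_neg (show right ≠ l - 1 by omega)]
  have hTl : ((t.swap left (l - 1)).swap right (g + 1)).arr (l - 1) = p := by
    rw [hT, if_neg (by omega), if_neg (by omega), if_pos rfl, hl]
    split_ifs with c
    · rw [c, hl]
    · rfl
  have hTg : ((t.swap left (l - 1)).swap right (g + 1)).arr (g + 1) = q := by
    rw [hT]
    split_ifs with c
    any_goals omega
    · rw [c, hg]
  refine ⟨by omega, fun i hi₁ hi₂ => ?_, fun i hi₁ hi₂ => ?_, hTl, hTg, fun i hi₁ hi₂ => ?_⟩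
  · rw [hT, if_neg (by omega), if_neg (by omega)]
    split_ifs with c₁ c₂
    · exact z₁ _ (by omega) (by omega)
    · omega
    · exact z₁ _ (by omega) (by omega)
  · rcases eq_or_lt_of_le hi₁ with rfl | hi₁
    · exact hTl.symm ▸ ⟨le_rfl, hpq.le⟩
    rcases eq_or_lt_of_le hi₂ with rfl | hi₂
    · exact hTg.symm ▸ ⟨hpq.le, le_rfl⟩
    rw [hT, if_neg (by omega), if_neg (by omega), if_neg (by omega), if_neg (by omega)]
    exact z₂ i (by omega) (by omega)
  · rw [hT]
    split_ifs
    any_goals omega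
    · exact z₃ _ (by omega) (by omega)
    · exact z₃ _ (by omega) (by omega)

theorem partitionStep_cost (h : 1 ≤ right - left) {p q : α}
    (hp : p = min (s.arr left) (s.arr right)) (hq : q = max (s.arr left) (s.arr right))
    {r : ℤ × ℤ × State α} (hr : r = partitionStep left right s) :
    (r.2.2.comparisons : ℤ) = s.comparisons + 1 +
      loopComparisons (fun i => smallInd p (s.arr i)) (fun i => largeInd q (s.arr i))
        (left + 1) (right - 1) (r.2.1 - 1) ∧
    (r.2.2.swaps : ℤ) = s.swaps + (if s.arr right < s.arr left then 1 else 0) +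
      loopSwaps (fun i => smallInd p (s.arr i)) (fun i => largeInd q (s.arr i))
        (left + 1) (right - 1) (r.2.1 - 1) + 2 := by
  have hpq : p ≤ q := by rw [hp, hq]; exact min_le_max
  simp only [partitionStep, orderPivots_arr_left, orderPivots_arr_right, ← hp, ← hq] at hr
  obtain ⟨c₁, c₂⟩ := outerLoop_cost hpq (l := left + 1) (g := right - 1) (k := left + 1)
    (orderPivots left right s) le_rfl (by omega)
  have b := outerLoop_bounds p q (left + 1) (right - 1) (left + 1) (orderPivots left right s)
    le_rfl (by omega)
  have b₂ := le_outerLoop_snd p q (left + 1) (right - 1) (left + 1) (orderPivots left right s)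
    (by omega)
  rw [loopComparisons_congr (fun i _ _ => congrArg (smallInd p)
      (orderPivots_arr_of_lt s (by omega) (by omega)))
    (fun i _ _ => congrArg (largeInd q) (orderPivots_arr_of_lt s (by omega) (by omega)))
    (by omega) b.2.2, orderPivots_comparisons] at c₁
  rw [loopSwaps_congr (fun i _ _ => congrArg (smallInd p)
      (orderPivots_arr_of_lt s (by omega) (by omega)))
    (fun i _ _ => congrArg (largeInd q) (orderPivots_arr_of_lt s (by omega) (by omega)))
    (by omega) b.2.2, orderPivots_swaps] at c₂
  generalize outerLoop p q (left + 1) (right - 1) (left + 1) (orderPivots left right s) = o at *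
  subst hr
  simp only [State.swap, add_sub_cancel_right]
  push_cast at c₁ c₂ ⊢
  rw [c₁, c₂]
  exact ⟨rfl, by ring⟩

end Specification

end DualPivotQuicksort

/-! ### Weighted cost and its locality -/

namespace DualPivotQuicksort

/-- The cost of a run where comparisons have weight `u` and swaps have weight `v`. -/
noncomputable def State.cost {α : Type*} (u v : ℝ) (s : State α) : ℝ :=
  u * s.comparisons + v * s.swaps

/-- The cost of sorting the range `lo, …, hi` of the array `a`. -/
noncomputable def sortCost {α : Type*} [LinearOrder α] (u v : ℝ) (lo hi : ℤ) (a : ℤ → α) : ℝ :=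
  (quicksort lo hi ⟨a, 0, 0⟩).cost u v

theorem Sim.cost_eq {α β : Type*} {f : α → β} {S : Set α} {lo hi d c w : ℤ} {s : State α}
    {s' : State β} (h : Sim f S lo hi d c w s s') (u v : ℝ) :
    s'.cost u v = s.cost u v + (u * c + v * w) := by
  have h₁ : (s'.comparisons : ℝ) = s.comparisons + c := mod_cast h.comparisons
  have h₂ : (s'.swaps : ℝ) = s.swaps + w := mod_cast h.swaps
  rw [State.cost, State.cost, h₁, h₂]
  ring

section Locality

variable {α : Type*} [LinearOrder α] (u v : ℝ)

/-- The run sees nothing but the entries of its range, and prior counter values are merely carried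
along: this is the simulation with `f = id`, no shift, and the old counters as offsets. -/
theorem cost_quicksort_eq_add_sortCost {lo hi : ℤ} (s : State α) {a : ℤ → α}
    (ha : ∀ i, lo ≤ i → i ≤ hi → s.arr i = a i) :
    (quicksort lo hi s).cost u v = s.cost u v + sortCost u v lo hi a := by
  have h : Sim id Set.univ lo hi 0 s.comparisons s.swaps ⟨a, 0, 0⟩ s :=
    ⟨fun _ _ _ => trivial, fun i h₁ h₂ => by rw [add_zero, ha i h₁ h₂]; rfl, by simp, by simp⟩
  have h' := (h.quicksort (strictMono_id.strictMonoOn _) le_rfl le_rfl).cost_eq u v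
  rw [add_zero, add_zero] at h'
  rw [h', sortCost]
  simp only [State.cost, Int.cast_natCast]
  ring

theorem sortCost_congr {lo hi : ℤ} {a b : ℤ → α} (h : ∀ i, lo ≤ i → i ≤ hi → a i = b i) :
    sortCost u v lo hi a = sortCost u v lo hi b := by
  rw [sortCost, cost_quicksort_eq_add_sortCost u v ⟨a, 0, 0⟩ h]
  simp [State.cost]

/-- The three recursive ranges are disjoint, so each call still finds in its range what the
partitioning step left there. -/
theorem cost_quicksort {left right : ℤ} (s : State α) (h : 1 ≤ right - left)
    {r : ℤ × ℤ × State α} (hr : r = partitionStep left right s) :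
    (quicksort left right s).cost u v = r.2.2.cost u v +
      (sortCost u v left (r.1 - 1) r.2.2.arr + sortCost u v (r.1 + 1) (r.2.1 - 1) r.2.2.arr +
        sortCost u v (r.2.1 + 1) right r.2.2.arr) := by
  have hb : left ≤ r.1 ∧ r.1 ≤ r.2.1 ∧ r.2.1 ≤ right := hr ▸ partitionStep_bounds left right s h
  rw [quicksort, dif_pos h]
  simp only [← hr]
  rw [cost_quicksort_eq_add_sortCost u v (a := r.2.2.arr),
    cost_quicksort_eq_add_sortCost u v (a := r.2.2.arr),
    cost_quicksort_eq_add_sortCost u v (a := r.2.2.arr)]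
  · ring
  · exact fun _ _ _ => rfl
  · exact fun i h₁ h₂ => (quicksort_isRearrangement left (r.1 - 1) r.2.2).apply_eq (by omega)
  · intro i h₁ h₂
    rw [(quicksort_isRearrangement (r.1 + 1) (r.2.1 - 1) _).apply_eq (by omega),
      (quicksort_isRearrangement left (r.1 - 1) r.2.2).apply_eq (by omega)]

end Locality

/-! ### Relabelling a block of values -/

section Permutations

variable {n : ℕ}

theorem initialState_arr_fin (π : Equiv.Perm (Fin n)) (x : Fin n) :
    (initialState π).arr ((x : ℕ) + 1 : ℤ) = (π x : ℕ) + 1 := by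
  have := x.isLt
  simp only [initialState]
  rw [dif_pos (by omega)]
  congr 3
  ext
  simp

theorem exists_fin_eq {i : ℤ} (h₁ : 1 ≤ i) (h₂ : i ≤ n) : ∃ x : Fin n, i = (x : ℕ) + 1 :=
  ⟨⟨(i - 1).toNat, by omega⟩, by simp only; omega⟩

/-- The action of a permutation of `{0, …, n-1}` on the array values `{1, …, n}`. -/
def valueAct (τ : Equiv.Perm (Fin n)) (x : ℕ) : ℕ :=
  if h : 1 ≤ x ∧ x ≤ n then (τ ⟨x - 1, by omega⟩ : ℕ) + 1 else 0

theorem valueAct_succ (τ : Equiv.Perm (Fin n)) (x : Fin n) :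
    valueAct τ ((x : ℕ) + 1) = (τ x : ℕ) + 1 := by
  have := x.isLt
  simp only [valueAct]
  rw [dif_pos (by omega)]
  congr 3

/-- The embedding of `{0, …, m-1}` onto the block `{j, …, j+m-1}` of `{0, …, n-1}`. -/
def blockEmb {j m : ℕ} (h : j + m ≤ n) : Fin m ↪ Fin n :=
  ⟨fun x => ⟨j + x, by omega⟩, fun x y hxy => by simpa [Fin.ext_iff] using hxy⟩

/-- The permutation of `{0, …, n-1}` that acts as `σ` on the block `{j, …, j+m-1}`. -/
def blockPerm {j m : ℕ} (h : j + m ≤ n) (σ : Equiv.Perm (Fin m)) : Equiv.Perm (Fin n) :=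
  σ.viaFintypeEmbedding (blockEmb h)

theorem blockPerm_apply_of_notMem {j m : ℕ} (h : j + m ≤ n) (σ : Equiv.Perm (Fin m)) {x : Fin n}
    (hx : (x : ℕ) < j ∨ j + m ≤ x) : blockPerm h σ x = x := by
  refine Equiv.Perm.viaFintypeEmbedding_apply_notMem_range _ _ ?_
  rintro ⟨y, rfl⟩
  have := y.isLt
  change (j + y : ℕ) < j ∨ j + m ≤ j + y at hx
  omega

theorem blockPerm_apply_of_mem {j m : ℕ} (h : j + m ≤ n) (σ : Equiv.Perm (Fin m)) (y : Fin m)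
    {x : Fin n} (hx : (x : ℕ) = j + y) : (blockPerm h σ x : ℕ) = j + σ y := by
  have : x = blockEmb h y := Fin.ext hx
  rw [this, blockPerm, Equiv.Perm.viaFintypeEmbedding_apply_image]
  rfl

/-- A block value stays in its block, and the whole block lies on one side of `a`. -/
theorem blockPerm_respects {j m : ℕ} (h : j + m ≤ n) (σ : Equiv.Perm (Fin m)) {a : Fin n}
    (ha : (a : ℕ) < j ∨ j + m ≤ a) :
    Respects (valueAct (blockPerm h σ)) (Set.Icc 1 n) ((a : ℕ) + 1) := by
  rintro y ⟨hy₁, hy₂⟩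
  obtain ⟨x, rfl⟩ : ∃ x : Fin n, y = x + 1 := ⟨⟨y - 1, by omega⟩, by simp only; omega⟩
  rw [valueAct_succ, valueAct_succ, blockPerm_apply_of_notMem h σ ha]
  by_cases hx : (x : ℕ) < j ∨ j + m ≤ x
  · rw [blockPerm_apply_of_notMem h σ hx]
    simp
  · have e := blockPerm_apply_of_mem h σ ⟨x - j, by omega⟩ (x := x) (by simp only; omega)
    have := (σ ⟨x - j, by omega⟩).isLt
    omega

variable (u v : ℝ)

/-- The total cost of sorting all permutations of `{1, …, n}`. -/
noncomputable def totalCost (n : ℕ) : ℝ := ∑ π : Equiv.Perm (Fin n), (run π).cost u v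

theorem sum_sortCost_block {j m : ℕ} (h : j + m ≤ n) (a : ℤ → ℕ)
    (ha : ∀ i : ℤ, j < i → i ≤ j + m → j < a i ∧ a i ≤ j + m)
    (hinj : Set.InjOn a {i : ℤ | j < i ∧ i ≤ j + m}) :
    ∑ σ : Equiv.Perm (Fin m),
      sortCost u v (j + 1) (j + m) (valueAct (blockPerm h σ) ∘ a) = totalCost u v m := by
  let ρ₀ : Fin m → Fin m := fun x => ⟨a (j + x + 1) - 1 - j, by
    have := ha (j + x + 1) (by omega) (by omega)
    omega⟩
  have hρ₀ : ∀ x : Fin m, a (j + x + 1) = j + (ρ₀ x : ℕ) + 1 := fun x => by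
    have := ha (j + x + 1) (by omega) (by omega)
    simp only [ρ₀]
    omega
  have hρ : Function.Bijective ρ₀ := by
    refine Finite.injective_iff_bijective.1 fun x y hxy => ?_
    have e : a (j + x + 1) = a (j + y + 1) := by rw [hρ₀, hρ₀, hxy]
    have := hinj (by simp only [Set.mem_ofPred_eq]; omega)
      (by simp only [Set.mem_ofPred_eq]; omega) e
    ext
    omega
  let ρ : Equiv.Perm (Fin m) := Equiv.ofBijective ρ₀ hρ
  -- The relabelled block reads `σ * ρ` up to translation by `j`, and `σ * ρ` runs over the whole
  -- group with `σ`.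
  refine (Finset.sum_congr rfl fun σ _ => ?_).trans
    (Equiv.sum_comp (Equiv.mulRight ρ) fun σ => (run σ).cost u v)
  have hsim : Sim (fun x : ℕ => x + j) Set.univ 1 m j 0 0 (initialState (σ * ρ))
      ⟨valueAct (blockPerm h σ) ∘ a, 0, 0⟩ := by
    refine ⟨fun _ _ _ => trivial, fun i h₁ h₂ => ?_, rfl, rfl⟩
    obtain ⟨x, rfl⟩ := exists_fin_eq h₁ h₂
    change valueAct (blockPerm h σ) (a _) = _
    rw [initialState_arr_fin,
      show ((x : ℕ) + 1 + j : ℤ) = j + x + 1 by ring, hρ₀]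
    have := valueAct_succ (blockPerm h σ) ⟨j + ρ₀ x, by omega⟩
    simp only at this
    rw [this, blockPerm_apply_of_mem h σ (ρ₀ x) rfl]
    simp only [Equiv.Perm.mul_apply, ρ, Equiv.ofBijective_apply]
    ring
  have hs := (hsim.quicksort (fun x _ y _ hxy => by simpa using hxy) le_rfl le_rfl).cost_eq u v
  simp only [Int.cast_zero, mul_zero, add_zero] at hs
  rw [sortCost, Equiv.coe_mulRight, run, ← hs, add_comm (1 : ℤ), add_comm (m : ℤ)]

end Permutations

end DualPivotQuicksort

/-! ### The first step on a permutation with prescribed pivots -/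

namespace DualPivotQuicksort

section Fibers

variable {N : ℕ}

theorem initialState_arr_first (π : Equiv.Perm (Fin (N + 2))) :
    (initialState π).arr 1 = (π 0 : ℕ) + 1 :=
  initialState_arr_fin π 0

theorem initialState_arr_last (π : Equiv.Perm (Fin (N + 2))) :
    (initialState π).arr ((N + 2 : ℕ) : ℤ) = (π (Fin.last (N + 1)) : ℕ) + 1 := by
  rw [← initialState_arr_fin π (Fin.last (N + 1))]
  simp [add_assoc]

theorem initialState_arr_bounds {n : ℕ} (π : Equiv.Perm (Fin n)) {i : ℤ} (h₁ : 1 ≤ i)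
    (h₂ : i ≤ n) : 1 ≤ (initialState π).arr i ∧ (initialState π).arr i ≤ n := by
  obtain ⟨x, rfl⟩ := exists_fin_eq h₁ h₂
  rw [initialState_arr_fin]
  have := (π x).isLt
  omega

theorem initialState_arr_injOn {n : ℕ} (π : Equiv.Perm (Fin n)) {i j : ℤ} (h₁ : 1 ≤ i)
    (h₂ : i ≤ n) (h₃ : 1 ≤ j) (h₄ : j ≤ n)
    (h : (initialState π).arr i = (initialState π).arr j) : i = j := by
  obtain ⟨x, rfl⟩ := exists_fin_eq h₁ h₂
  obtain ⟨y, rfl⟩ := exists_fin_eq h₃ h₄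
  rw [initialState_arr_fin, initialState_arr_fin] at h
  rw [π.injective (Fin.ext (Nat.succ_injective h))]

theorem card_le_of_mapsTo {a b : ℤ} {c d : ℕ} {T : ℤ → ℕ}
    (hT : ∀ i, a ≤ i → i ≤ b → c ≤ T i ∧ T i < d)
    (hinj : ∀ i j, a ≤ i → i ≤ b → a ≤ j → j ≤ b → T i = T j → i = j) :
    (b + 1 - a).toNat ≤ d - c := by
  rw [← Int.card_Icc, ← Nat.card_Ico]
  refine Finset.card_le_card_of_injOn T (fun i hi => ?_) fun i hi j hj h => ?_
  · rw [Finset.mem_coe, Finset.mem_Icc] at hi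
    rw [Finset.mem_coe, Finset.mem_Ico]
    exact hT i hi.1 hi.2
  · rw [Finset.mem_coe, Finset.mem_Icc] at hi hj
    exact hinj i j hi.1 hi.2 hj.1 hj.2 h

/-- The first partitioning step on a permutation of `{1, …, N+2}`. -/
def firstStep (π : Equiv.Perm (Fin (N + 2))) : ℤ × ℤ × State ℕ :=
  partitionStep 1 ((N + 2 : ℕ) : ℤ) (initialState π)

theorem firstStep_arr (π : Equiv.Perm (Fin (N + 2))) :
    (∀ i : ℤ, 1 ≤ i → i ≤ N + 2 →
      1 ≤ (firstStep π).2.2.arr i ∧ (firstStep π).2.2.arr i ≤ N + 2) ∧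
    (∀ i j : ℤ, 1 ≤ i → i ≤ N + 2 → 1 ≤ j → j ≤ N + 2 →
      (firstStep π).2.2.arr i = (firstStep π).2.2.arr j → i = j) := by
  obtain ⟨τ, hτ, he⟩ := (partitionStep_isRearrangement (left := 1)
    (right := ((N + 2 : ℕ) : ℤ)) (initialState π) (by omega)).exists_perm
  change (firstStep π).2.2.arr = _ at he
  rw [he]
  push_cast at hτ
  refine ⟨fun i h₁ h₂ => ?_, fun i j h₁ h₂ h₃ h₄ h => ?_⟩
  · exact initialState_arr_bounds π (hτ i h₁ h₂).1 (by push_cast; exact (hτ i h₁ h₂).2)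
  · exact τ.injective (initialState_arr_injOn π (hτ i h₁ h₂).1
      (by push_cast; exact (hτ i h₁ h₂).2) (hτ j h₃ h₄).1
      (by push_cast; exact (hτ j h₃ h₄).2) h)

/-- Each zone embeds its positions into its admissible values. Two opposite counts for each pivot
position (`c₁`, `c₂` and `c₄`, `c₃`) pin it to the pivot's rank; injectivity then removes the pivot
values from the middle zone. -/
theorem firstStep_spec (π : Equiv.Perm (Fin (N + 2))) {p q : ℕ}
    (hp : p = min (π 0 : ℕ) (π (Fin.last (N + 1)))) (hq : q = max (π 0 : ℕ) (π (Fin.last (N + 1)))) :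
    (p < q ∧ q < N + 2) ∧ (firstStep π).1 = p + 1 ∧ (firstStep π).2.1 = q + 1 ∧
    (∀ i : ℤ, 1 ≤ i → i ≤ p → (firstStep π).2.2.arr i ≤ p) ∧
    (∀ i : ℤ, p + 1 < i → i ≤ q →
      p + 1 < (firstStep π).2.2.arr i ∧ (firstStep π).2.2.arr i ≤ q) ∧
    (∀ i : ℤ, q + 1 < i → i ≤ N + 2 → q + 1 < (firstStep π).2.2.arr i) := by
  have hne' : (π 0 : ℕ) ≠ π (Fin.last (N + 1)) := fun h => by
    have := π.injective (Fin.ext h)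
    simp [Fin.ext_iff] at this
  have hne : (initialState π).arr 1 ≠ (initialState π).arr ((N + 2 : ℕ) : ℤ) := by
    rw [initialState_arr_first, initialState_arr_last]
    omega
  have hb₀ := (π 0).isLt
  have hb₁ := (π (Fin.last (N + 1))).isLt
  obtain ⟨⟨b₁, b₂, b₃⟩, z₁, z₂, e₁, e₂, z₃⟩ := partitionStep_zones (initialState π)
    (p := p + 1) (q := q + 1) (by omega) hne
    (by rw [initialState_arr_first, initialState_arr_last]; omega)
    (by rw [initialState_arr_first, initialState_arr_last]; omega) (r := firstStep π) rfl
  obtain ⟨hB, hI⟩ := firstStep_arr π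
  generalize firstStep π = r at *
  push_cast at b₃ z₃
  have c₁ := card_le_of_mapsTo (a := 1) (b := r.1 - 1) (c := 1) (d := p + 1) (T := r.2.2.arr)
    (fun i h₁ h₂ => ⟨(hB i h₁ (by omega)).1, z₁ i h₁ (by omega)⟩)
    (fun i j h₁ h₂ h₃ h₄ => hI i j h₁ (by omega) h₃ (by omega))
  have c₂ := card_le_of_mapsTo (a := r.1) (b := N + 2) (c := p + 1) (d := N + 3) (T := r.2.2.arr)
    (fun i h₁ h₂ => ⟨by
      rcases le_or_gt i r.2.1 with h | h
      · exact (z₂ i h₁ h).1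
      · have := z₃ i h h₂
        omega, Nat.lt_succ_of_le (hB i (by omega) h₂).2⟩)
    (fun i j h₁ h₂ h₃ h₄ => hI i j (by omega) h₂ (by omega) h₄)
  have c₃ := card_le_of_mapsTo (a := r.2.1 + 1) (b := N + 2) (c := q + 2) (d := N + 3)
    (T := r.2.2.arr)
    (fun i h₁ h₂ => ⟨z₃ i (by omega) h₂, Nat.lt_succ_of_le (hB i (by omega) h₂).2⟩)
    (fun i j h₁ h₂ h₃ h₄ => hI i j (by omega) h₂ (by omega) h₄)
  have c₄ := card_le_of_mapsTo (a := 1) (b := r.2.1) (c := 1) (d := q + 2) (T := r.2.2.arr)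
    (fun i h₁ h₂ => ⟨(hB i h₁ (by omega)).1, by
      rcases lt_or_ge i r.1 with h | h
      · have := z₁ i h₁ h
        omega
      · have := (z₂ i h h₂).2
        omega⟩)
    (fun i j h₁ h₂ h₃ h₄ => hI i j h₁ (by omega) h₃ (by omega))
  have e₃ : r.1 = p + 1 := by omega
  have e₄ : r.2.1 = q + 1 := by omega
  refine ⟨⟨by omega, by omega⟩, e₃, e₄, fun i h₁ h₂ => ?_, fun i h₁ h₂ => ?_, fun i h₁ h₂ => ?_⟩
  · have := z₁ i h₁ (by omega)
    omega
  · have h := z₂ i (by omega) (by omega)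
    have h₃ : r.2.2.arr i ≠ p + 1 := fun hc => by
      have := hI i r.1 (by omega) (by omega) (by omega) (by omega) (hc.trans e₁.symm)
      omega
    have h₄ : r.2.2.arr i ≠ q + 1 := fun hc => by
      have := hI i r.2.1 (by omega) (by omega) (by omega) (by omega) (hc.trans e₂.symm)
      omega
    omega
  · exact z₃ i (by omega) h₂

/-- The permutations whose first and last values are `a` and `b`. -/
def pivotFiber (a b : Fin (N + 2)) : Finset (Equiv.Perm (Fin (N + 2))) :=
  Finset.univ.filter fun π => π 0 = a ∧ π (Fin.last (N + 1)) = b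

theorem mem_pivotFiber {a b : Fin (N + 2)} {π : Equiv.Perm (Fin (N + 2))} :
    π ∈ pivotFiber a b ↔ π 0 = a ∧ π (Fin.last (N + 1)) = b := by
  simp [pivotFiber]

/-- The pivots lie outside the block, so the step cannot tell block values apart and makes the same
moves. -/
theorem firstStep_blockPerm_mul {j m : ℕ} (h : j + m ≤ N + 2) {a b : Fin (N + 2)}
    (ha : (a : ℕ) < j ∨ j + m ≤ a) (hb : (b : ℕ) < j ∨ j + m ≤ b) (σ : Equiv.Perm (Fin m))
    {π : Equiv.Perm (Fin (N + 2))} (hπ : π ∈ pivotFiber a b) {i : ℤ} (h₁ : 1 ≤ i)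
    (h₂ : i ≤ N + 2) :
    (firstStep (blockPerm h σ * π)).2.2.arr i =
      valueAct (blockPerm h σ) ((firstStep π).2.2.arr i) := by
  obtain ⟨rfl, rfl⟩ := mem_pivotFiber.1 hπ
  have hs : Sim (valueAct (blockPerm h σ)) (Set.Icc 1 (N + 2)) 1 ((N + 2 : ℕ) : ℤ) 0 0 0
      (initialState π) (initialState (blockPerm h σ * π)) := by
    refine ⟨fun i h₁ h₂ => initialState_arr_bounds π h₁ h₂, fun i h₁ h₂ => ?_, rfl, rfl⟩
    obtain ⟨x, rfl⟩ := exists_fin_eq h₁ h₂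
    rw [add_zero, initialState_arr_fin, initialState_arr_fin, valueAct_succ]
    rfl
  have := (hs.partitionStep (left := 1) (right := ((N + 2 : ℕ) : ℤ))
    (by rw [initialState_arr_first]; exact blockPerm_respects h σ ha)
    (by rw [initialState_arr_last]; exact blockPerm_respects h σ hb) le_rfl (by omega) le_rfl
    (by omega)).2.2.arr i h₁ (by push_cast; exact h₂)
  rwa [add_zero, add_zero, add_zero] at this

variable (u v : ℝ)

/-- Left multiplication by a block permutation maps the fibre onto itself, so the sum may be
averaged over all `σ`. After exchanging the sums, each `π` contributes the total cost for size `m`: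
conditional on the pivots, the subarray is uniformly random. -/
theorem sum_pivotFiber_sortCost {j m : ℕ} (h : j + m ≤ N + 2) {a b : Fin (N + 2)}
    (ha : (a : ℕ) < j ∨ j + m ≤ a) (hb : (b : ℕ) < j ∨ j + m ≤ b)
    (hT : ∀ π ∈ pivotFiber a b, ∀ i : ℤ, j < i → i ≤ j + m →
      j < (firstStep π).2.2.arr i ∧ (firstStep π).2.2.arr i ≤ j + m) :
    (m ! : ℝ) * ∑ π ∈ pivotFiber a b, sortCost u v (j + 1) (j + m) (firstStep π).2.2.arr =
      (pivotFiber a b).card * totalCost u v m := by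
  have key : ∀ σ : Equiv.Perm (Fin m),
      ∑ π ∈ pivotFiber a b, sortCost u v (j + 1) (j + m) (firstStep π).2.2.arr =
      ∑ π ∈ pivotFiber a b, sortCost u v (j + 1) (j + m)
        (valueAct (blockPerm h σ) ∘ (firstStep π).2.2.arr) := by
    intro σ
    symm
    refine Finset.sum_equiv (Equiv.mulLeft (blockPerm h σ)) (fun π => ?_) fun π hπ => ?_
    · rw [mem_pivotFiber, mem_pivotFiber, Equiv.coe_mulLeft, Equiv.Perm.mul_apply,
        Equiv.Perm.mul_apply]
      conv_lhs => rw [← (blockPerm h σ).apply_eq_iff_eq, ← (blockPerm h σ).apply_eq_iff_eq (y := b),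
        blockPerm_apply_of_notMem h σ ha, blockPerm_apply_of_notMem h σ hb]
    · exact sortCost_congr u v fun i h₁ h₂ =>
        (firstStep_blockPerm_mul h ha hb σ hπ (by omega) (by omega)).symm
  have hc : (m ! : ℝ) = (Finset.univ : Finset (Equiv.Perm (Fin m))).card := by
    rw [Finset.card_univ, Fintype.card_perm, Fintype.card_fin]
  rw [hc, ← nsmul_eq_mul, ← Finset.sum_const, Finset.sum_congr rfl fun σ _ => key σ,
    Finset.sum_comm, ← nsmul_eq_mul, ← Finset.sum_const]
  refine Finset.sum_congr rfl fun π hπ => sum_sortCost_block u v h _ (hT π hπ) ?_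
  rintro x ⟨hx₁, hx₂⟩ y ⟨hy₁, hy₂⟩ hxy
  exact (firstStep_arr π).2 x y (by omega) (by omega) (by omega) (by omega) hxy

end Fibers

end DualPivotQuicksort

/-! ### Counting and averaging over pivot fibres -/

namespace DualPivotQuicksort

theorem sum_range_sum_range_ne (F : ℕ → ℕ → ℝ) (n : ℕ) :
    ∑ a ∈ Finset.range n, ∑ b ∈ Finset.range n, (if a = b then 0 else F a b) =
      ∑ q ∈ Finset.range n, ∑ p ∈ Finset.range q, (F p q + F q p) := by
  induction n with
  | zero => simp
  | succ n ih =>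
    rw [Finset.sum_range_succ, Finset.sum_range_succ (fun q => ∑ p ∈ Finset.range q, _) n, ← ih]
    simp only [Finset.sum_range_succ, Finset.sum_add_distrib, if_true, add_zero]
    rw [add_assoc]
    congr 2 <;> refine Finset.sum_congr rfl fun x hx => ?_
    · exact if_neg (Finset.mem_range.1 hx).ne
    · exact if_neg (Finset.mem_range.1 hx).ne'

theorem sum_fin_lt {n p : ℕ} (h : p ≤ n) :
    ∑ y : Fin n, (if (y : ℕ) < p then (1 : ℝ) else 0) = p := by
  rw [Fin.sum_univ_eq_sum_range (fun y => if y < p then (1 : ℝ) else 0) n, Finset.sum_boole,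
    show (Finset.range n).filter (· < p) = Finset.range p by ext x; simp; omega,
    Finset.card_range]

theorem sum_fin_gt {n q : ℕ} (h : q < n) :
    ∑ y : Fin n, (if q < (y : ℕ) then (1 : ℝ) else 0) = n - 1 - q := by
  have e : ∀ y : Fin n, (if q < (y : ℕ) then (1 : ℝ) else 0) =
      1 - if (y : ℕ) < q + 1 then (1 : ℝ) else 0 := fun y => by
    split_ifs <;> first | omega | norm_num
  rw [Finset.sum_congr rfl fun y _ => e y, Finset.sum_sub_distrib, sum_fin_lt h]
  simp
  ring

section Fibers

variable {N : ℕ}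

theorem pivotFiber_self (a : Fin (N + 2)) : pivotFiber a a = ∅ := by
  ext π
  simp only [mem_pivotFiber, Finset.notMem_empty, iff_false]
  rintro ⟨h₁, h₂⟩
  have := π.injective (h₁.trans h₂.symm)
  simp [Fin.ext_iff] at this

theorem sum_eq_sum_pivotFiber (F : Equiv.Perm (Fin (N + 2)) → ℝ) :
    ∑ π, F π = ∑ a, ∑ b, ∑ π ∈ pivotFiber a b, F π := by
  rw [← Finset.sum_fiberwise Finset.univ (fun π : Equiv.Perm (Fin (N + 2)) => π 0)]
  refine Finset.sum_congr rfl fun a _ => ?_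
  rw [← Finset.sum_fiberwise _ fun π : Equiv.Perm (Fin (N + 2)) => π (Fin.last (N + 1))]
  refine Finset.sum_congr rfl fun b _ => Finset.sum_congr ?_ fun _ _ => rfl
  rw [Finset.filter_filter, pivotFiber]

theorem card_pivotFiber_eq {a b a' b' : Fin (N + 2)} (h : a ≠ b) (h' : a' ≠ b') :
    (pivotFiber a b).card = (pivotFiber a' b').card := by
  have hc : Equiv.swap a a' b ≠ a' := fun hc => by
    exact h ((Equiv.swap a a').injective (hc.trans (Equiv.swap_apply_left a a').symm)).symm
  obtain ⟨σ, ha, hb⟩ : ∃ σ : Equiv.Perm (Fin (N + 2)), σ a = a' ∧ σ b = b' := by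
    refine ⟨Equiv.swap b' (Equiv.swap a a' b) * Equiv.swap a a', ?_, by simp⟩
    rw [Equiv.Perm.mul_apply, Equiv.swap_apply_left]
    exact Equiv.swap_apply_of_ne_of_ne h' hc.symm
  refine Finset.card_equiv (Equiv.mulLeft σ) fun π => ?_
  rw [mem_pivotFiber, mem_pivotFiber, Equiv.coe_mulLeft, ← ha, ← hb, Equiv.Perm.mul_apply,
    Equiv.Perm.mul_apply, σ.apply_eq_iff_eq, σ.apply_eq_iff_eq]

/-- The `(N + 2)(N + 1)` fibres with distinct pivots have equal size and partition `(N + 2)!`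
permutations. -/
theorem card_pivotFiber {a b : Fin (N + 2)} (h : a ≠ b) : ((pivotFiber a b).card : ℝ) = N ! := by
  have hs := sum_eq_sum_pivotFiber fun _ : Equiv.Perm (Fin (N + 2)) => (1 : ℝ)
  have e : ∀ a' b' : Fin (N + 2), ∑ π ∈ pivotFiber a' b', (1 : ℝ) =
      (pivotFiber a b).card - if a' = b' then ((pivotFiber a b).card : ℝ) else 0 := by
    intro a' b'
    split_ifs with h'
    · rw [h', pivotFiber_self, Finset.sum_empty, sub_self]
    · rw [card_pivotFiber_eq h h']
      simp
  simp only [e] at hs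
  simp [Finset.sum_sub_distrib, Fintype.card_perm, Nat.factorial_succ] at hs
  have h₁ : ((N : ℝ) + 2) * (N + 1) ≠ 0 := by positivity
  apply mul_left_cancel₀ h₁
  linarith

/-- Exchanging two inner positions preserves the fibre, so all `N` of them contribute equally. Over
all positions the contributions add up to `N ! * ∑ x, f x`, and the ends give nothing because `f`
vanishes at both pivots. -/
theorem sum_pivotFiber_apply {a b : Fin (N + 2)} (hab : a ≠ b) (f : Fin (N + 2) → ℝ)
    (ha : f a = 0) (hb : f b = 0) {i : Fin (N + 2)} (h₁ : i ≠ 0) (h₂ : i ≠ Fin.last (N + 1)) :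
    ∑ π ∈ pivotFiber a b, f (π i) = N ! * ((∑ x, f x) / N) := by
  have hN : (N : ℝ) ≠ 0 := by
    rintro hN
    rw [Nat.cast_eq_zero] at hN
    subst hN
    have := i.isLt
    simp only [ne_eq, Fin.ext_iff, Fin.val_zero, Fin.val_last] at h₁ h₂
    omega
  have hsym : ∀ i' : Fin (N + 2), i' ≠ 0 → i' ≠ Fin.last (N + 1) →
      ∑ π ∈ pivotFiber a b, f (π i') = ∑ π ∈ pivotFiber a b, f (π i) := by
    intro i' h₃ h₄
    refine Finset.sum_equiv (Equiv.mulRight (Equiv.swap i i')) (fun π => ?_) fun π _ => ?_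
    · rw [mem_pivotFiber, mem_pivotFiber, Equiv.coe_mulRight, Equiv.Perm.mul_apply,
        Equiv.Perm.mul_apply, Equiv.swap_apply_of_ne_of_ne h₁.symm h₃.symm,
        Equiv.swap_apply_of_ne_of_ne h₂.symm h₄.symm]
    · simp
  have hsum : ∑ i', ∑ π ∈ pivotFiber a b, f (π i') = N ! * ∑ x, f x := by
    rw [Finset.sum_comm, Finset.sum_congr rfl fun π _ => Equiv.sum_comp π f, Finset.sum_const,
      nsmul_eq_mul, card_pivotFiber hab]
  have hz : ∑ π ∈ pivotFiber a b, f (π 0) = 0 :=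
    Finset.sum_eq_zero fun π hπ => by rw [(mem_pivotFiber.1 hπ).1, ha]
  have hl : ∑ π ∈ pivotFiber a b, f (π (Fin.last (N + 1))) = 0 :=
    Finset.sum_eq_zero fun π hπ => by rw [(mem_pivotFiber.1 hπ).2, hb]
  have hint : ∀ y : Fin N, ∑ π ∈ pivotFiber a b, f (π y.castSucc.succ) =
      ∑ π ∈ pivotFiber a b, f (π i) := fun y => hsym _ (Fin.succ_ne_zero _) (by
        rw [ne_eq, ← Fin.succ_last, Fin.succ_inj]
        exact y.castSucc_lt_last.ne)
  rw [Fin.sum_univ_succ, hz, Fin.sum_univ_castSucc, Fin.succ_last, hl,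
    Finset.sum_congr rfl fun y _ => hint y] at hsum
  simp only [Finset.sum_const, Finset.card_univ, Fintype.card_fin, nsmul_eq_mul] at hsum
  field_simp
  linarith

variable {a b : Fin (N + 2)} {p q : ℕ}

theorem exists_inner_fin_eq {i : ℤ} (h₁ : 2 ≤ i) (h₂ : i ≤ N + 1) :
    ∃ x : Fin (N + 2), x ≠ 0 ∧ x ≠ Fin.last (N + 1) ∧ i = (x : ℕ) + 1 := by
  obtain ⟨x, rfl⟩ := exists_fin_eq (n := N + 2) (i := i) (by omega) (by push_cast; omega)
  refine ⟨x, ?_, ?_, rfl⟩ <;> rintro rfl <;> simp at h₁ h₂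

theorem sum_pivotFiber_smallInd (hab : a ≠ b) (hp : p = min (a : ℕ) b) {i : ℤ} (h₁ : 2 ≤ i)
    (h₂ : i ≤ N + 1) :
    ∑ π ∈ pivotFiber a b, (smallInd (p + 1) ((initialState π).arr i) : ℝ) = N ! * (p / N) := by
  obtain ⟨x, hx₁, hx₂, rfl⟩ := exists_inner_fin_eq h₁ h₂
  rw [← sum_fin_lt (n := N + 2) (p := p) (by omega), ← sum_pivotFiber_apply hab _
    (if_neg (by omega)) (if_neg (by omega)) hx₁ hx₂]
  refine Finset.sum_congr rfl fun π _ => ?_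
  rw [initialState_arr_fin, smallInd]
  simp

theorem sum_pivotFiber_largeInd (hab : a ≠ b) (hq : q = max (a : ℕ) b) {i : ℤ} (h₁ : 2 ≤ i)
    (h₂ : i ≤ N + 1) :
    ∑ π ∈ pivotFiber a b, (largeInd (q + 1) ((initialState π).arr i) : ℝ) =
      N ! * ((N + 1 - q) / N) := by
  obtain ⟨x, hx₁, hx₂, rfl⟩ := exists_inner_fin_eq h₁ h₂
  have e : (N + 1 - q : ℝ) = ((N + 2 : ℕ) : ℝ) - 1 - q := by push_cast; ring
  rw [e, ← sum_fin_gt (n := N + 2) (q := q) (by omega), ← sum_pivotFiber_apply hab _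
    (if_neg (by omega)) (if_neg (by omega)) hx₁ hx₂]
  refine Finset.sum_congr rfl fun π _ => ?_
  rw [initialState_arr_fin, largeInd]
  simp

end Fibers

end DualPivotQuicksort

/-! ### Mean cost given the pivots -/

namespace DualPivotQuicksort

section Fibers

variable {N : ℕ}

theorem firstStep_cost {π : Equiv.Perm (Fin (N + 2))} {p q : ℕ}
    (hp : p = min (π 0 : ℕ) (π (Fin.last (N + 1))))
    (hq : q = max (π 0 : ℕ) (π (Fin.last (N + 1)))) :
    ((firstStep π).2.2.comparisons : ℝ) = N + 1 +
      ∑ i ∈ Finset.Icc (2 : ℤ) q, (1 - (smallInd (p + 1) ((initialState π).arr i) : ℝ) +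
        (largeInd (q + 1) ((initialState π).arr i) : ℝ)) +
      3 * (if q < N + 1 then (largeInd (q + 1) ((initialState π).arr (q + 1)) : ℝ) else 0) ∧
    ((firstStep π).2.2.swaps : ℝ) = (if π (Fin.last (N + 1)) < π 0 then 1 else 0) +
      ∑ i ∈ Finset.Icc (2 : ℤ) (N + 1), (smallInd (p + 1) ((initialState π).arr i) : ℝ) +
      ∑ i ∈ Finset.Icc (2 : ℤ) q, (largeInd (q + 1) ((initialState π).arr i) : ℝ) +
      (if q < N + 1 then (largeInd (q + 1) ((initialState π).arr (q + 1)) : ℝ) else 0) + 2 := by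
  obtain ⟨-, -, hg, -⟩ := firstStep_spec π hp hq
  obtain ⟨c₁, c₂⟩ := partitionStep_cost (left := 1) (right := ((N + 2 : ℕ) : ℤ))
    (p := p + 1) (q := q + 1) (initialState π) (by omega)
    (by rw [initialState_arr_first, initialState_arr_last]; omega)
    (by rw [initialState_arr_first, initialState_arr_last]; omega) (r := firstStep π) rfl
  rw [hg, loopComparisons, one_add_one_eq_two, add_sub_cancel_right,
    show (((N + 2 : ℕ) : ℤ) - 1) = N + 1 by push_cast; ring] at c₁
  rw [hg, loopSwaps, one_add_one_eq_two, add_sub_cancel_right,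
    show (((N + 2 : ℕ) : ℤ) - 1) = N + 1 by push_cast; ring, initialState_arr_first,
    initialState_arr_last] at c₂
  have hlt : (q : ℤ) < N + 1 ↔ q < N + 1 := by omega
  have hlt' : (π (Fin.last (N + 1)) : ℕ) + 1 < (π 0 : ℕ) + 1 ↔ π (Fin.last (N + 1)) < π 0 := by
    rw [Nat.add_lt_add_iff_right, Fin.lt_def]
  simp only [hlt, hlt'] at c₁ c₂
  have d₁ := congrArg (Int.cast : ℤ → ℝ) c₁
  have d₂ := congrArg (Int.cast : ℤ → ℝ) c₂
  push_cast at d₁ d₂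
  rw [d₁, d₂]
  simp only [initialState, Nat.cast_zero]
  constructor <;> ring

/-- The mean cost of the first partitioning step when the pivots are `p < q` in
`{0, …, N+1}`, apart from the swap that orders the pivots. -/
noncomputable def stepCost (u v : ℝ) (N p q : ℕ) : ℝ :=
  u * (N + q + (q - 1) * ((N + 1 - q) / N - p / N) + 3 * ((N + 1 - q) / N)) +
    v * (p + q * ((N + 1 - q) / N) + 2)

variable (u v : ℝ) {a b : Fin (N + 2)} {p q : ℕ}

theorem sum_pivotFiber_cost (hab : a ≠ b) (hp : p = min (a : ℕ) b) (hq : q = max (a : ℕ) b) :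
    ∑ π ∈ pivotFiber a b, (firstStep π).2.2.cost u v =
      N ! * (stepCost u v N p q + v * if b < a then 1 else 0) := by
  have hab' : (a : ℕ) ≠ b := fun h => hab (Fin.ext h)
  have hq₁ : 1 ≤ q := by omega
  have hq₂ : q ≤ N + 1 := by omega
  have hK : ∀ c : ℝ, ∑ π ∈ pivotFiber a b, c = N ! * c := fun c => by
    rw [Finset.sum_const, nsmul_eq_mul, card_pivotFiber hab]
  have hd : ∑ π ∈ pivotFiber a b,
      (if q < N + 1 then (largeInd (q + 1) ((initialState π).arr (q + 1)) : ℝ) else 0) =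
      N ! * ((N + 1 - q) / N) := by
    split_ifs with h
    · exact sum_pivotFiber_largeInd hab hq (by omega) (by omega)
    -- No value exceeds `q`, and both sides vanish. This includes `N = 0`, where the quotient is `0
    -- / 0 = 0`.
    · rw [show q = N + 1 by omega]
      simp
  have hsm : ∑ i ∈ Finset.Icc (2 : ℤ) (N + 1), ∑ π ∈ pivotFiber a b,
      (smallInd (p + 1) ((initialState π).arr i) : ℝ) = N ! * p := by
    rw [Finset.sum_congr rfl fun i hi => sum_pivotFiber_smallInd hab hp (Finset.mem_Icc.1 hi).1
      (Finset.mem_Icc.1 hi).2, Finset.sum_const, Int.card_Icc, nsmul_eq_mul]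
    rcases Nat.eq_zero_or_pos N with rfl | hN
    · rw [show p = 0 by omega]
      simp
    · rw [show ((N : ℤ) + 1 + 1 - 2).toNat = N by omega]
      field_simp
  have hcard : ((Finset.Icc (2 : ℤ) q).card : ℝ) = q - 1 := by
    rw [Int.card_Icc, show ((q : ℤ) + 1 - 2).toNat = q - 1 by omega, Nat.cast_pred hq₁]
  have hlg : ∑ i ∈ Finset.Icc (2 : ℤ) q, ∑ π ∈ pivotFiber a b,
      (largeInd (q + 1) ((initialState π).arr i) : ℝ) =
      N ! * ((q - 1) * ((N + 1 - q) / N)) := by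
    rw [Finset.sum_congr rfl fun i hi => sum_pivotFiber_largeInd hab hq (Finset.mem_Icc.1 hi).1
      ((Finset.mem_Icc.1 hi).2.trans (by omega)), Finset.sum_const, nsmul_eq_mul, hcard]
    ring
  have hc : ∑ i ∈ Finset.Icc (2 : ℤ) q, ∑ π ∈ pivotFiber a b,
      (1 - (smallInd (p + 1) ((initialState π).arr i) : ℝ) +
        (largeInd (q + 1) ((initialState π).arr i) : ℝ)) =
      N ! * ((q - 1) * (1 - p / N + (N + 1 - q) / N)) := by
    simp only [Finset.sum_add_distrib, Finset.sum_sub_distrib, hK]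
    rw [hlg, Finset.sum_congr rfl fun i hi => sum_pivotFiber_smallInd hab hp (Finset.mem_Icc.1 hi).1
      ((Finset.mem_Icc.1 hi).2.trans (by omega)), Finset.sum_const, Finset.sum_const,
      nsmul_eq_mul, nsmul_eq_mul, hcard]
    ring
  have hπ : ∀ π ∈ pivotFiber a b, _ := fun π hπ => by
    obtain ⟨h₁, h₂⟩ := mem_pivotFiber.1 hπ
    exact firstStep_cost (π := π) (p := p) (q := q) (by rw [h₁, h₂, hp]) (by rw [h₁, h₂, hq])
  have hC : ∑ π ∈ pivotFiber a b, ((firstStep π).2.2.comparisons : ℝ) =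
      N ! * (N + q + (q - 1) * ((N + 1 - q) / N - p / N) + 3 * ((N + 1 - q) / N)) := by
    rw [Finset.sum_congr rfl fun π h => (hπ π h).1, Finset.sum_add_distrib,
      Finset.sum_add_distrib, ← Finset.mul_sum, hd, hK, Finset.sum_comm, hc]
    ring
  have hW : ∑ π ∈ pivotFiber a b, ((firstStep π).2.2.swaps : ℝ) =
      N ! * ((if b < a then 1 else 0) + p + q * ((N + 1 - q) / N) + 2) := by
    have hif : ∑ π ∈ pivotFiber a b, (if π (Fin.last (N + 1)) < π 0 then (1 : ℝ) else 0) =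
        N ! * if b < a then 1 else 0 := by
      rw [← hK]
      refine Finset.sum_congr rfl fun π h => ?_
      rw [(mem_pivotFiber.1 h).1, (mem_pivotFiber.1 h).2]
    rw [Finset.sum_congr rfl fun π h => (hπ π h).2, Finset.sum_add_distrib,
      Finset.sum_add_distrib, Finset.sum_add_distrib, Finset.sum_add_distrib, hd, hK, hif,
      Finset.sum_comm, hsm, Finset.sum_comm, hlg]
    ring
  simp only [State.cost, Finset.sum_add_distrib, ← Finset.mul_sum, hC, hW, stepCost]
  ring

/-- The mean cost of sorting a random permutation of `{1, …, n}`. -/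
noncomputable def meanCost (n : ℕ) : ℝ := totalCost u v n / n !

theorem sum_pivotFiber_run (hab : a ≠ b) (hp : p = min (a : ℕ) b) (hq : q = max (a : ℕ) b) :
    ∑ π ∈ pivotFiber a b, (run π).cost u v =
      N ! * (stepCost u v N p q + v * (if b < a then 1 else 0) +
        (meanCost u v p + meanCost u v (q - 1 - p) + meanCost u v (N + 1 - q))) := by
  have hab' : (a : ℕ) ≠ b := fun h => hab (Fin.ext h)
  have hspec : ∀ π ∈ pivotFiber a b, _ := fun π hπ => by
    obtain ⟨h₁, h₂⟩ := mem_pivotFiber.1 hπ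
    exact firstStep_spec π (p := p) (q := q) (by rw [h₁, h₂, hp]) (by rw [h₁, h₂, hq])
  have hblock : ∀ (j m : ℕ) (h : j + m ≤ N + 2) (ha : (a : ℕ) < j ∨ j + m ≤ a)
      (hb : (b : ℕ) < j ∨ j + m ≤ b)
      (hT : ∀ π ∈ pivotFiber a b, ∀ i : ℤ, j < i → i ≤ j + m →
        j < (firstStep π).2.2.arr i ∧ (firstStep π).2.2.arr i ≤ j + m),
      ∑ π ∈ pivotFiber a b, sortCost u v (j + 1) (j + m) (firstStep π).2.2.arr =
        N ! * meanCost u v m := by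
    intro j m h ha hb hT
    have := sum_pivotFiber_sortCost u v h ha hb hT
    rw [card_pivotFiber hab] at this
    have hm : (m ! : ℝ) ≠ 0 := Nat.cast_ne_zero.2 (Nat.factorial_ne_zero m)
    rw [meanCost]
    field_simp
    linarith
  -- The pivot values `p < q` cut `{0, …, N + 1}` into blocks at offsets `0`, `p + 1`, `q + 1`, of
  -- sizes `p`, `q - 1 - p`, `N + 1 - q`.
  have h₁ := hblock 0 p (by omega) (by omega) (by omega) fun π hπ i h₁ h₂ =>
    ⟨((firstStep_arr π).1 i (by omega) (by omega)).1, by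
      have := (hspec π hπ).2.2.2.1 i (by omega) (by omega)
      omega⟩
  have h₂ := hblock (p + 1) (q - 1 - p) (by omega) (by omega) (by omega) fun π hπ i h₁ h₂ => by
    have := (hspec π hπ).2.2.2.2.1 i (by omega) (by omega)
    omega
  have h₃ := hblock (q + 1) (N + 1 - q) (by omega) (by omega) (by omega) fun π hπ i h₁ h₂ => by
    have := (hspec π hπ).2.2.2.2.2 i (by omega) (by omega)
    have := ((firstStep_arr π).1 i (by omega) (by omega)).2
    omega
  rw [mul_add, mul_add _ (_ + _), mul_add _ (meanCost u v p), ← h₁, ← h₂, ← h₃, ← sum_pivotFiber_cost u v hab hp hq,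
    ← Finset.sum_add_distrib, ← Finset.sum_add_distrib, ← Finset.sum_add_distrib]
  refine Finset.sum_congr rfl fun π hπ => ?_
  obtain ⟨-, e₁, e₂, -⟩ := hspec π hπ
  rw [run, cost_quicksort u v _ (by omega) (r := firstStep π) rfl, e₁, e₂]
  push_cast
  congr 3
  all_goals first | omega | skip
  all_goals congr 1; omega

end Fibers

end DualPivotQuicksort

/-! ### The recurrence and its solution -/

namespace DualPivotQuicksort

/-- Both sides count `E p` exactly `n - 1 - p` times. This gives the rightmost subarray the same
total contribution as the other two. -/
theorem sum_range_mul_reflect (E : ℕ → ℝ) (n : ℕ) :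
    ∑ q ∈ Finset.range n, q * E (n - 1 - q) =
      ∑ q ∈ Finset.range n, ∑ p ∈ Finset.range q, E p := by
  induction n with
  | zero => simp
  | succ n ih =>
    rw [Finset.sum_range_succ', Finset.sum_range_succ (fun q => ∑ p ∈ Finset.range q, E p), ← ih,
      ← Finset.sum_range_reflect E n, ← Finset.sum_add_distrib]
    simp only [Nat.cast_zero, zero_mul, add_zero]
    refine Finset.sum_congr rfl fun q _ => ?_
    rw [show n + 1 - 1 - (q + 1) = n - 1 - q by omega]
    push_cast
    ring

theorem sum_range_id_real (n : ℕ) : ∑ q ∈ Finset.range n, (q : ℝ) = n * (n - 1) / 2 := by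
  induction n with
  | zero => simp
  | succ n ih => rw [Finset.sum_range_succ, ih]; push_cast; ring

theorem sum_range_sq_real (n : ℕ) :
    ∑ q ∈ Finset.range n, (q : ℝ) ^ 2 = n * (n - 1) * (2 * n - 1) / 6 := by
  induction n with
  | zero => simp
  | succ n ih => rw [Finset.sum_range_succ, ih]; push_cast; ring

theorem sum_range_cube_real (n : ℕ) :
    ∑ q ∈ Finset.range n, (q : ℝ) ^ 3 = (n * (n - 1) / 2) ^ 2 := by
  induction n with
  | zero => simp
  | succ n ih => rw [Finset.sum_range_succ, ih]; push_cast; ring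

variable (u v : ℝ)

/-- The mean cost of the first partitioning step on `n` elements, for `n ≥ 3`. -/
noncomputable def toll (n : ℕ) : ℝ :=
  u * (19 / 12 * (n + 1) - 3) + v * ((n + 1) / 2 + 7 / 6)

/-- Each pair `p < q` occurs in two orders, one of which costs an extra swap. The summand is affine
in `p`, and its sum over `p` is a cubic polynomial in `q`. For `N = 0` the quotients in `stepCost`
degenerate. -/
theorem sum_stepCost {N : ℕ} (hN : 1 ≤ N) :
    ∑ q ∈ Finset.range (N + 2), ∑ p ∈ Finset.range q, (2 * stepCost u v N p q + v) =
      (N + 2) * (N + 1) * toll u v (N + 2) := by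
  have hN' : (N : ℝ) ≠ 0 := by positivity
  have h : ∀ q : ℕ, ∑ p ∈ Finset.range q, (2 * stepCost u v N p q + v) =
      (2 * (u * (N + 2 * (N + 1) / N) + 2 * v) + v - (v - u * (-1 / N))) * (q : ℝ) +
      (2 * (u * (1 + (N + 1 + 1 - 3) / N) + v * ((N + 1) / N)) + (v + u / N) + u / N) * (q : ℝ) ^ 2 +
      (2 * (u * (-1 / N) + v * (-1 / N)) - u / N) * (q : ℝ) ^ 3 := by
    intro q
    have e : ∀ p : ℕ, 2 * stepCost u v N p q + v =
        (2 * (u * (N + q + (q - 1) * ((N + 1 - q) / N) + 3 * ((N + 1 - q) / N)) +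
          v * (q * ((N + 1 - q) / N) + 2)) + v) + (2 * (v - u * (q - 1) / N)) * p := fun p => by
      rw [stepCost]
      ring
    simp only [e, Finset.sum_add_distrib, ← Finset.mul_sum, sum_range_id_real, Finset.sum_const,
      Finset.card_range, nsmul_eq_mul]
    field_simp
    ring
  simp only [h, Finset.sum_add_distrib, ← Finset.mul_sum, sum_range_id_real, sum_range_sq_real,
    sum_range_cube_real, toll]
  push_cast
  field_simp
  ring

/-- The factor `6` is two orders of the pivots times three subarrays with equal total contributions,
by reflection in `p` and by `sum_range_mul_reflect`. -/
theorem meanCost_add_two_eq_sum (N : ℕ) :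
    (N + 2) * (N + 1) * meanCost u v (N + 2) =
      ∑ q ∈ Finset.range (N + 2), ∑ p ∈ Finset.range q, (2 * stepCost u v N p q + v) +
      6 * ∑ q ∈ Finset.range (N + 2), ∑ p ∈ Finset.range q, meanCost u v p := by
  let G : ℕ → ℕ → ℝ := fun p q =>
    stepCost u v N p q + (meanCost u v p + meanCost u v (q - 1 - p) + meanCost u v (N + 1 - q))
  let F : ℕ → ℕ → ℝ := fun a b => G (min a b) (max a b) + v * if b < a then 1 else 0
  have hF : ∀ a b : Fin (N + 2), ∑ π ∈ pivotFiber a b, (run π).cost u v =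
      N ! * if (a : ℕ) = b then 0 else F a b := by
    intro a b
    split_ifs with h
    · rw [Fin.ext h, pivotFiber_self, Finset.sum_empty, mul_zero]
    · rw [sum_pivotFiber_run u v (fun e => h (congrArg _ e)) rfl rfl]
      simp only [F, G, Fin.lt_def]
      ring
  have hT : totalCost u v (N + 2) =
      N ! * ∑ q ∈ Finset.range (N + 2), ∑ p ∈ Finset.range q, (F p q + F q p) := by
    rw [totalCost, sum_eq_sum_pivotFiber, ← sum_range_sum_range_ne]
    simp only [hF, ← Finset.mul_sum]
    congr 1
    rw [← Fin.sum_univ_eq_sum_range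
      (fun a => ∑ b ∈ Finset.range (N + 2), if a = b then 0 else F a b)]
    refine Finset.sum_congr rfl fun a _ => ?_
    exact Fin.sum_univ_eq_sum_range (fun b => if (a : ℕ) = b then 0 else F a b) (N + 2)
  have hG : ∀ q ∈ Finset.range (N + 2), ∑ p ∈ Finset.range q, (F p q + F q p) =
      ∑ p ∈ Finset.range q, (2 * stepCost u v N p q + v) +
      2 * (∑ p ∈ Finset.range q, meanCost u v p + ∑ p ∈ Finset.range q, meanCost u v p +
        q * meanCost u v (N + 2 - 1 - q)) := by
    intro q _
    have e : ∀ p ∈ Finset.range q, F p q + F q p = (2 * stepCost u v N p q + v) +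
        2 * (meanCost u v p + meanCost u v (q - 1 - p) + meanCost u v (N + 2 - 1 - q)) := by
      intro p hp
      have hp := Finset.mem_range.1 hp
      simp only [F, G, min_eq_left hp.le, min_eq_right hp.le, max_eq_left hp.le,
        max_eq_right hp.le, if_pos hp, if_neg (lt_asymm hp)]
      rw [show N + 2 - 1 - q = N + 1 - q by omega]
      ring
    rw [Finset.sum_congr rfl e]
    simp only [Finset.sum_add_distrib, ← Finset.mul_sum, Finset.sum_range_reflect (meanCost u v),
      Finset.sum_const, Finset.card_range, nsmul_eq_mul]
  rw [Finset.sum_congr rfl hG, Finset.sum_add_distrib, ← Finset.mul_sum, Finset.sum_add_distrib,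
    Finset.sum_add_distrib, sum_range_mul_reflect] at hT
  have hf : (N ! : ℝ) ≠ 0 := Nat.cast_ne_zero.2 (Nat.factorial_ne_zero N)
  rw [meanCost, hT, Nat.factorial_succ, Nat.factorial_succ]
  push_cast
  field_simp
  ring

theorem meanCost_recurrence {n : ℕ} (hn : 3 ≤ n) :
    n * (n - 1) * meanCost u v n = n * (n - 1) * toll u v n +
      6 * ∑ q ∈ Finset.range n, ∑ p ∈ Finset.range q, meanCost u v p := by
  obtain ⟨N, rfl⟩ := Nat.exists_eq_add_of_le' (show 2 ≤ n by omega)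
  have := meanCost_add_two_eq_sum u v N
  rw [sum_stepCost u v (by omega)] at this
  push_cast
  linear_combination this

theorem meanCost_of_le_one {n : ℕ} (hn : n ≤ 1) : meanCost u v n = 0 := by
  have : ∀ π : Equiv.Perm (Fin n), (run π).cost u v = 0 := fun π => by
    rw [run, quicksort, dif_neg (by omega)]
    simp [State.cost, initialState]
  simp [meanCost, totalCost, this]

theorem meanCost_two : meanCost u v 2 = u + 5 / 2 * v := by
  have := meanCost_add_two_eq_sum u v 0
  simp [Finset.sum_range_succ, meanCost_of_le_one u v zero_le_one, stepCost] at this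
  linarith

/-- The closed form of the mean cost, for `n ≥ 4`. -/
noncomputable def closedForm (n : ℕ) : ℝ :=
  u * (19 / 10 * ((n : ℝ) + 1) * (harmonic (n + 1) : ℝ) - 711 / 200 * ((n : ℝ) + 1) + 3 / 2) +
    v * (3 / 5 * ((n : ℝ) + 1) * (harmonic (n + 1) : ℝ) - 27 / 100 * ((n : ℝ) + 1) - 7 / 12)

/-- The sum `∑ q < n, ∑ p < q` of the mean costs, in closed form. -/
noncomputable def closedSum (n : ℕ) : ℝ := n * (n - 1) / 6 * (closedForm u v n - toll u v n)

theorem harmonic_succ_real (n : ℕ) : (harmonic (n + 1) : ℝ) = harmonic n + 1 / ((n : ℝ) + 1) := by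
  rw [harmonic_succ]
  push_cast
  rw [one_div]

/-- `closedSum` is the double sum that the recurrence would force from `closedForm`; its second
difference must therefore be `closedForm`. A toll `a (n + 1)` yields `6 a / 5 * (n + 1) H (n + 1)`
modulo multiples of `n + 1`, and a constant toll `c` yields `-c / 2`; hence the coefficients
`19/10`, `3/5`, `3/2`, `-7/12`. -/
theorem closedSum_step (n : ℕ) : closedSum u v (n + 2) - closedSum u v (n + 1) =
    closedSum u v (n + 1) - closedSum u v n + closedForm u v n := by
  have h₁ : (n : ℝ) + 1 + 1 ≠ 0 := by positivity
  have h₂ : (n : ℝ) + 1 + 1 + 1 ≠ 0 := by positivity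
  simp only [closedSum, closedForm, toll, harmonic_succ_real (n + 2), harmonic_succ_real (n + 1)]
  push_cast
  generalize (harmonic (n + 1) : ℝ) = h
  rw [show (n : ℝ) + 2 + 1 = n + 1 + 1 + 1 by ring]
  field_simp
  ring

/-- The induction carries the double sum and its first difference along with the mean. It can start
at `4`: for `n = 3` the factor `6 / (n (n - 1))` is `1`, so with `D` the double sum, `D 3` cancels
from `D 5 - 2 * D 4 + D 3 = toll 3 + D 3`. This removes the second homogeneous solution, and `D 4 =
meanCost 2` fixes the multiple of `n + 1`, hence `711/200` and `27/100`. -/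
theorem meanCost_eq_closedForm_aux {n : ℕ} (hn : 4 ≤ n) :
    meanCost u v n = closedForm u v n ∧
    ∑ q ∈ Finset.range n, ∑ p ∈ Finset.range q, meanCost u v p = closedSum u v n ∧
    ∑ p ∈ Finset.range n, meanCost u v p = closedSum u v (n + 1) - closedSum u v n := by
  induction n, hn using Nat.le_induction with
  | base =>
    have h₀ := meanCost_of_le_one u v zero_le_one
    have h₁ := meanCost_of_le_one u v le_rfl
    have h₂ := meanCost_two u v
    have h₃ := meanCost_recurrence u v (n := 3) le_rfl
    have h₄ := meanCost_recurrence u v (n := 4) (by norm_num)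
    have H₄ : (harmonic 4 : ℝ) = 25 / 12 := by norm_num [harmonic, Finset.sum_range_succ]
    have H₅ : (harmonic 5 : ℝ) = 137 / 60 := by norm_num [harmonic, Finset.sum_range_succ]
    have H₆ : (harmonic 6 : ℝ) = 49 / 20 := by norm_num [harmonic, Finset.sum_range_succ]
    simp only [Finset.sum_range_succ, Finset.sum_range_zero, toll, h₀, h₁, h₂] at h₃ h₄
    norm_num at h₃ h₄
    simp only [Finset.sum_range_succ, Finset.sum_range_zero, closedSum, closedForm, toll, h₀, h₁,
      h₂, Nat.reduceAdd, H₅, H₆]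
    norm_num
    refine ⟨?_, ?_, ?_⟩ <;> linarith
  | succ n hn ih =>
    obtain ⟨i₁, i₂, i₃⟩ := ih
    have hD : ∑ q ∈ Finset.range (n + 1), ∑ p ∈ Finset.range q, meanCost u v p =
        closedSum u v (n + 1) := by
      rw [Finset.sum_range_succ, i₂, i₃]
      ring
    refine ⟨?_, hD, ?_⟩
    · have h := meanCost_recurrence u v (n := n + 1) (by omega)
      rw [hD, closedSum] at h
      have hpos : ((n + 1 : ℕ) : ℝ) * ((n + 1 : ℕ) - 1) ≠ 0 := by
        have : (n : ℝ) ≠ 0 := by positivity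
        push_cast
        rw [add_sub_cancel_right]
        positivity
      apply mul_left_cancel₀ hpos
      linear_combination h
    · rw [Finset.sum_range_succ, i₃, i₁, ← closedSum_step]

theorem meanCost_eq_closedForm {n : ℕ} (hn : 4 ≤ n) : meanCost u v n = closedForm u v n :=
  (meanCost_eq_closedForm_aux u v hn).1

theorem expectedComparisons_eq {n : ℕ} (hn : 4 ≤ n) : expectedComparisons n =
    19 / 10 * ((n : ℝ) + 1) * (harmonic (n + 1) : ℝ) - 711 / 200 * ((n : ℝ) + 1) + 3 / 2 := by
  have := meanCost_eq_closedForm 1 0 hn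
  simpa [expectedComparisons, meanCost, totalCost, State.cost, closedForm] using this

theorem expectedSwaps_eq {n : ℕ} (hn : 4 ≤ n) : expectedSwaps n =
    3 / 5 * ((n : ℝ) + 1) * (harmonic (n + 1) : ℝ) - 27 / 100 * ((n : ℝ) + 1) - 7 / 12 := by
  have := meanCost_eq_closedForm 0 1 hn
  simpa [expectedSwaps, meanCost, totalCost, State.cost, closedForm] using this

end DualPivotQuicksort

/-! ### Numerical bounds on the Euler–Mascheroni constant and the asymptotics -/

namespace DualPivotQuicksort

section EulerMascheroni

open Real

/-- Rounding scaled reciprocals down (and up in the next lemma) turns harmonic bounds into a kernel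
computation with natural numbers. -/
theorem sum_div_le_mul_harmonic (M n : ℕ) :
    ((∑ i ∈ Finset.range n, M / (i + 1) : ℕ) : ℝ) ≤ M * harmonic n := by
  rw [harmonic]
  push_cast
  rw [Finset.mul_sum]
  refine Finset.sum_le_sum fun i _ => ?_
  have := Nat.cast_div_le (α := ℝ) (m := M) (n := i + 1)
  push_cast at this
  rwa [← div_eq_mul_inv]

theorem mul_harmonic_le_sum_div_add_one (M n : ℕ) :
    M * harmonic n ≤ ((∑ i ∈ Finset.range n, (M / (i + 1) + 1) : ℕ) : ℝ) := by
  rw [harmonic]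
  push_cast
  rw [Finset.mul_sum]
  refine Finset.sum_le_sum fun i _ => ?_
  rw [← div_eq_mul_inv, div_le_iff₀ (by positivity)]
  exact_mod_cast (Nat.lt_div_mul_add (a := M) i.succ_pos).le.trans (by rw [add_mul, one_mul])

theorem log_five_hundred_twelve : log 512 = 9 * log 2 := by
  rw [show (512 : ℝ) = 2 ^ 9 by norm_num, log_pow]
  norm_num

/-- The value `0.575` is exactly what the swap coefficient requires: `(0.27 + 0.075) / 0.6`. The
index `511` makes the logarithm `log 512 = 9 log 2`. -/
theorem lt_eulerMascheroniConstant : 0.575 < eulerMascheroniConstant := by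
  refine lt_of_lt_of_le ?_ (eulerMascheroniSeq_lt_eulerMascheroniConstant 511).le
  have h₁ : 68134000 ≤ ∑ i ∈ Finset.range 511, 10000000 / (i + 1) := by decide +kernel
  have h₂ := (Nat.cast_le (α := ℝ).2 h₁).trans (sum_div_le_mul_harmonic 10000000 511)
  have h₃ := log_two_lt_d9
  rw [Nat.cast_ofNat, Nat.cast_ofNat] at h₂
  rw [eulerMascheroniSeq, show ((511 : ℕ) : ℝ) + 1 = 512 by norm_num, log_five_hundred_twelve]
  linarith

/-- The comparison coefficient requires `γ < 1.1 / 1.9 = 0.57894…`, from `(3.555 - 2.455) / 1.9`. -/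
theorem eulerMascheroniConstant_lt : eulerMascheroniConstant < 0.5789 := by
  refine lt_of_le_of_lt (eulerMascheroniConstant_lt_eulerMascheroniSeq' 512).le ?_
  have h₁ : ∑ i ∈ Finset.range 512, (10000000 / (i + 1) + 1) ≤ 68171000 := by decide +kernel
  have h₂ := (mul_harmonic_le_sum_div_add_one 10000000 512).trans (Nat.cast_le (α := ℝ).2 h₁)
  have h₃ := log_two_gt_d9
  rw [Nat.cast_ofNat, Nat.cast_ofNat] at h₂
  rw [eulerMascheroniSeq', if_neg (by norm_num), show ((512 : ℕ) : ℝ) = 512 by norm_num,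
    log_five_hundred_twelve]
  linarith

/-- `γ` lies between `H n - log (n + 1)` and `H n - log n`, which differ by at most `1 / n`. -/
theorem harmonic_sub_log_bounds {n : ℕ} (hn : n ≠ 0) :
    0 ≤ (harmonic n : ℝ) - log n - eulerMascheroniConstant ∧
      (n + 1) * ((harmonic n : ℝ) - log n - eulerMascheroniConstant) ≤ 2 := by
  have h₁ := eulerMascheroniConstant_lt_eulerMascheroniSeq' n
  have h₂ := eulerMascheroniSeq_lt_eulerMascheroniConstant n
  rw [eulerMascheroniSeq', if_neg hn] at h₁
  rw [eulerMascheroniSeq] at h₂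
  have hpos : (1 : ℝ) ≤ n := mod_cast Nat.one_le_iff_ne_zero.2 hn
  have h₃ : log (n + 1) - log n ≤ 1 / n := by
    rw [← log_div (by positivity) (by positivity)]
    refine (log_le_sub_one_of_pos (by positivity)).trans (le_of_eq ?_)
    field_simp
    ring
  refine ⟨by linarith, ?_⟩
  have h₄ : (harmonic n : ℝ) - log n - eulerMascheroniConstant ≤ 1 / n := by linarith
  calc (n + 1) * ((harmonic n : ℝ) - log n - eulerMascheroniConstant)
      ≤ (n + 1) * (1 / n) := by gcongr
    _ ≤ 2 := by
      rw [mul_one_div, div_le_iff₀ (by positivity)]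
      linarith

/-- Since `(n + 1) H (n + 1) = (n + 1) H n + 1`, the error is `c (n + 1) (H n - log n - γ)`, which
is bounded, plus `c log n` and a constant. -/
theorem isBigO_log_of_eq_harmonic {f : ℕ → ℝ} {c k e : ℝ} {n₀ : ℕ}
    (hf : ∀ n, n₀ ≤ n → f n = c * ((n : ℝ) + 1) * (harmonic (n + 1) : ℝ) - k * ((n : ℝ) + 1) + e) :
    (fun n : ℕ => f n - (c * (n : ℝ) * log n + (c * eulerMascheroniConstant - k) * (n : ℝ)))
      =O[atTop] (fun n : ℕ => log n) := by
  have hlog : Tendsto (fun n : ℕ => log n) atTop atTop :=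
    tendsto_log_atTop.comp tendsto_natCast_atTop_atTop
  have hconst : ∀ d : ℝ, (fun _ : ℕ => d) =O[atTop] (fun n : ℕ => log n) := fun d =>
    (isLittleO_const_left.2 (.inr (tendsto_norm_atTop_atTop.comp hlog))).isBigO
  have hδ : (fun n : ℕ => ((n : ℝ) + 1) * ((harmonic n : ℝ) - log n - eulerMascheroniConstant))
      =O[atTop] (fun _ : ℕ => (2 : ℝ)) := by
    refine IsBigO.of_bound 1 ?_
    filter_upwards [eventually_ne_atTop 0] with n hn
    obtain ⟨h₁, h₂⟩ := harmonic_sub_log_bounds hn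
    rw [norm_of_nonneg (by positivity), one_mul, norm_of_nonneg (by norm_num)]
    exact h₂
  refine IsBigO.congr' ((((hδ.trans (hconst 2)).const_mul_left c).add
    ((isBigO_refl (fun n : ℕ => log n) atTop).const_mul_left c)).add
    (hconst (c * (eulerMascheroniConstant + 1) - k + e))) ?_ EventuallyEq.rfl
  filter_upwards [eventually_ge_atTop n₀] with n hn
  rw [hf n hn, harmonic_succ_real]
  have : (n : ℝ) + 1 ≠ 0 := by positivity
  field_simp
  ring

end EulerMascheroni

end DualPivotQuicksort

theorem mainTheorem1 :
    (∀ n : ℕ, 4 ≤ n →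
      DualPivotQuicksort.expectedComparisons n =
          19 / 10 * ((n : ℝ) + 1) * (harmonic (n + 1) : ℝ) - 711 / 200 * ((n : ℝ) + 1) + 3 / 2 ∧
      DualPivotQuicksort.expectedSwaps n =
          3 / 5 * ((n : ℝ) + 1) * (harmonic (n + 1) : ℝ) - 27 / 100 * ((n : ℝ) + 1) - 7 / 12) ∧
    (fun n : ℕ => DualPivotQuicksort.expectedComparisons n -
        (19 / 10 * (n : ℝ) * Real.log n +
          (19 / 10 * Real.eulerMascheroniConstant - 711 / 200) * (n : ℝ)))
      =O[atTop] (fun n : ℕ => Real.log n) ∧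
    |(19 / 10 * Real.eulerMascheroniConstant - 711 / 200) - (-2.46)| < 0.005 ∧
    (fun n : ℕ => DualPivotQuicksort.expectedSwaps n -
        (3 / 5 * (n : ℝ) * Real.log n +
          (3 / 5 * Real.eulerMascheroniConstant - 27 / 100) * (n : ℝ)))
      =O[atTop] (fun n : ℕ => Real.log n) ∧
    |(3 / 5 * Real.eulerMascheroniConstant - 27 / 100) - 0.08| < 0.005 := by
  have h₁ := DualPivotQuicksort.lt_eulerMascheroniConstant
  have h₂ := DualPivotQuicksort.eulerMascheroniConstant_lt
  norm_num at h₁ h₂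
  refine ⟨fun n hn => ⟨DualPivotQuicksort.expectedComparisons_eq hn,
    DualPivotQuicksort.expectedSwaps_eq hn⟩,
    DualPivotQuicksort.isBigO_log_of_eq_harmonic fun n hn =>
      DualPivotQuicksort.expectedComparisons_eq hn, ?_,
    DualPivotQuicksort.isBigO_log_of_eq_harmonic (e := -(7 / 12)) fun n hn =>
      (DualPivotQuicksort.expectedSwaps_eq hn).trans (sub_eq_add_neg _ _), ?_⟩
  · rw [abs_lt]
    constructor <;> norm_num <;> linarith
  · rw [abs_lt]
    constructor <;> norm_num <;> linarith
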